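/- Let $[n]=A\sqcup B\sqcup C$ be a partition of $n$ qubits with $|A|=1$. Let $Q_1,\dots,Q_m$ be sets of $k$ qubits each ($m$, $k$ and the sets are arbitrary). Let $U=U_mU_{m-1}\cdots U_1$ be the random circuit in which $U_1,\dots,U_m$ are independent Haar-random $k$-qubit unitaries, with $U_j$ acting on the qubits in $Q_j$ (and trivially on the others). Let $D=D_m\cdots D_1$ be the random circuit with the same supports in which the $D_j$ are independent, uniformly random $k$-qubit Clifford unitaries (up to global phase). For $x\in\{0,1\}^{B}$ let $\Pi(x)=|x\rangle\langle x|_B\otimes I_{AC}$, let $q(x)=\langle 0^n|U^\dagger\Pi(x)U|0^n\rangle$ be the probability of outcome $x$ when the qubits of $B$ are measured in the computational basis, and let $\rho(x)=\frac{1}{q(x)}\mathrm{Tr}_{BC}\big(\Pi(x)U|0^n\rangle\langle 0^n|U^\dagger\Pi(x)\big)$ be the post-measurement state of $A$. For $s\in\{0,1\}^n$ put $Z(s)=\prod_j Z_j^{s_j}$. For $P\in\{X,Y,Z\}$ let $S_P$ be the set of all $s\in\{0,1\}^n$ such that $DZ(s)D^\dagger=(-1)^\alpha P_A\otimes Z(r)_B\otimes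 I_C$ for some $r\in\{0,1\}^{B}$ and $\alpha\in\{0,1\}$, and let $S=S_X\cup S_Y\cup S_Z$. Let $P_{AB}(0)=\langle 0^n|U^\dagger(|0\rangle\langle 0|_{AB}\otimes I_C)U|0^n\rangle$ and $\chi=4^{|AB|}\,\mathbb{E}_U[P_{AB}(0)^2]-1$. Then $$\mathbb{E}_U\mathbb{E}_{x\sim q}\mathrm{Tr}(\rho(x)^2)\le \frac12+\frac12\sqrt{3\,\mathbb{E}_D|S|},\qquad \frac13\mathbb{E}_D|S|\le\chi,$$ and consequently $$\mathbb{E}_U\mathbb{E}_{x\sim q}\mathrm{Tr}(\rho(x)^2)\le \frac12+\frac32\sqrt{\chi}.$$ -/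

import Mathlib

open MeasureTheory Matrix
open scoped ComplexConjugate

noncomputable section

namespace MIE

/-! ### Qubits, unitaries and the Haar measure -/

/-- Computational basis labels of `n` qubits; `false` is `0` and `true` is `1`. -/
abbrev Bits (n : ℕ) : Type := Fin n → Bool

/-- Operators on the Hilbert space of `n` qubits, as matrices in the computational basis. -/
abbrev Op (n : ℕ) : Type := Matrix (Bits n) (Bits n) ℂ

/-- The unitary group of `k` qubits. -/
abbrev QU (k : ℕ) : Type := Matrix.unitaryGroup (Bits k) ℂ

instance instMeasurableSpaceQU (k : ℕ) : MeasurableSpace (QU k) := borel _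

instance instBorelSpaceQU (k : ℕ) : BorelSpace (QU k) := ⟨rfl⟩

instance instSecondCountableQU (k : ℕ) : SecondCountableTopology (QU k) :=
  inferInstanceAs (SecondCountableTopology
    {A : Bits k → Bits k → ℂ // (Matrix.of A : Op k) ∈ Matrix.unitaryGroup (Bits k) ℂ})

instance instCompactSpaceQU (k : ℕ) : CompactSpace (QU k) := by
  refine isCompact_iff_compactSpace.mp ?_
  have hc : IsClosed {A : Op k | A * star A = 1} :=
    isClosed_eq (continuous_id.mul continuous_star) continuous_const
  have hK : IsCompact (Set.pi Set.univ fun _ : Bits k =>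
      Set.pi Set.univ fun _ : Bits k => Metric.closedBall (0 : ℂ) 1) :=
    isCompact_univ_pi fun _ => isCompact_univ_pi fun _ => isCompact_closedBall 0 1
  refine IsCompact.of_isClosed_subset hK ?_ ?_
  · convert hc using 1
    ext A
    exact Matrix.mem_unitaryGroup_iff
  · intro A hA i _ j _
    simpa using entry_norm_bound_of_unitary hA i j

/-- The Haar probability measure on the unitary group of `k` qubits. -/
def haarU (k : ℕ) : Measure (QU k) := Measure.haarMeasure ⊤

instance instIsProbabilityMeasureHaarU (k : ℕ) : IsProbabilityMeasure (haarU k) :=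
  ⟨by simpa [haarU] using Measure.haarMeasure_self (K₀ := (⊤ : TopologicalSpace.PositiveCompacts (QU k)))⟩

/-! ### Pauli operators -/

/-- The labels of the four single-qubit Pauli operators. -/
inductive Pauli where
  | I
  | X
  | Y
  | Z
  deriving DecidableEq

instance instFintypePauli : Fintype Pauli :=
  ⟨{Pauli.I, Pauli.X, Pauli.Y, Pauli.Z}, fun P => by cases P <;> decide⟩

/-- The `2 × 2` matrix of a Pauli operator. -/
def Pauli.mat : Pauli → Matrix Bool Bool ℂ
  | Pauli.I => Matrix.of fun i j => if i = j then 1 else 0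
  | Pauli.X => Matrix.of fun i j => if i = j then 0 else 1
  | Pauli.Y => Matrix.of fun i j => if i = j then 0 else if i then Complex.I else -Complex.I
  | Pauli.Z => Matrix.of fun i j => if i = j then (if i then -1 else 1) else 0

/-- The tensor product of the Pauli operators `p i`, where `p i` acts on qubit `i`. -/
def pauliString {n : ℕ} (p : Fin n → Pauli) : Op n :=
  Matrix.of fun y z => ∏ i, (p i).mat (y i) (z i)

/-- `Z(s)`, the product of the operators `Z_j` over the qubits `j` with `s j = 1`. -/
def zString {n : ℕ} (s : Bits n) : Op n :=
  pauliString fun i => if s i then Pauli.Z else Pauli.I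

/-! ### The Clifford group -/

theorem Pauli.mat_mul (P Q : Pauli) :
    ∃ (a : ℕ) (R : Pauli), P.mat * Q.mat = Complex.I ^ a • R.mat := by
  cases P <;> cases Q
  case I.I => exact ⟨0, .I, by ext i j; cases i <;> cases j <;> simp [Pauli.mat, Matrix.mul_apply]⟩
  case I.X => exact ⟨0, .X, by ext i j; cases i <;> cases j <;> simp [Pauli.mat, Matrix.mul_apply]⟩
  case I.Y => exact ⟨0, .Y, by ext i j; cases i <;> cases j <;> simp [Pauli.mat, Matrix.mul_apply]⟩
  case I.Z => exact ⟨0, .Z, by ext i j; cases i <;> cases j <;> simp [Pauli.mat, Matrix.mul_apply]⟩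
  case X.I => exact ⟨0, .X, by ext i j; cases i <;> cases j <;> simp [Pauli.mat, Matrix.mul_apply]⟩
  case X.X => exact ⟨0, .I, by ext i j; cases i <;> cases j <;> simp [Pauli.mat, Matrix.mul_apply]⟩
  case X.Y => exact ⟨1, .Z, by ext i j; cases i <;> cases j <;> simp [Pauli.mat, Matrix.mul_apply]⟩
  case X.Z => exact ⟨3, .Y, by ext i j; cases i <;> cases j <;> simp [Pauli.mat, Matrix.mul_apply]⟩
  case Y.I => exact ⟨0, .Y, by ext i j; cases i <;> cases j <;> simp [Pauli.mat, Matrix.mul_apply]⟩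
  case Y.X => exact ⟨3, .Z, by ext i j; cases i <;> cases j <;> simp [Pauli.mat, Matrix.mul_apply]⟩
  case Y.Y => exact ⟨0, .I, by ext i j; cases i <;> cases j <;> simp [Pauli.mat, Matrix.mul_apply]⟩
  case Y.Z => exact ⟨1, .X, by ext i j; cases i <;> cases j <;> simp [Pauli.mat, Matrix.mul_apply]⟩
  case Z.I => exact ⟨0, .Z, by ext i j; cases i <;> cases j <;> simp [Pauli.mat, Matrix.mul_apply]⟩
  case Z.X => exact ⟨1, .Y, by ext i j; cases i <;> cases j <;> simp [Pauli.mat, Matrix.mul_apply]⟩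
  case Z.Y => exact ⟨3, .X, by ext i j; cases i <;> cases j <;> simp [Pauli.mat, Matrix.mul_apply]⟩
  case Z.Z => exact ⟨0, .I, by ext i j; cases i <;> cases j <;> simp [Pauli.mat, Matrix.mul_apply]⟩

theorem pauliString_mul {n : ℕ} (p q : Fin n → Pauli) :
    ∃ (a : ℕ) (r : Fin n → Pauli),
      pauliString p * pauliString q = Complex.I ^ a • pauliString r := by
  choose a r h using fun i => Pauli.mat_mul (p i) (q i)
  refine ⟨∑ i, a i, r, ?_⟩
  ext y z
  have h' : ∀ i, ∑ b : Bool, (p i).mat (y i) b * (q i).mat b (z i) =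
      Complex.I ^ a i * (r i).mat (y i) (z i) := fun i => by
    have := congrFun (congrFun (h i) (y i)) (z i)
    simpa only [Matrix.mul_apply, Matrix.smul_apply, smul_eq_mul] using this
  simp only [pauliString, Matrix.mul_apply, Matrix.smul_apply, Matrix.of_apply, smul_eq_mul,
    ← Finset.prod_mul_distrib, ← Finset.prod_pow_eq_pow_sum, ← h']
  rw [Finset.prod_univ_sum, Fintype.piFinset_univ]

theorem pauliString_one (n : ℕ) : pauliString (fun _ : Fin n => Pauli.I) = 1 := by
  ext y z
  by_cases h : y = z
  · subst h; simp [pauliString, Pauli.mat]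
  · obtain ⟨i, hi⟩ := Function.ne_iff.mp h
    rw [Matrix.one_apply_ne h]
    exact Finset.prod_eq_zero (Finset.mem_univ i) (by simp [Pauli.mat, hi])

theorem pauliString_star {n : ℕ} (p : Fin n → Pauli) : star (pauliString p) = pauliString p := by
  ext y z
  simp only [pauliString, Matrix.star_apply, Matrix.of_apply, star_prod]
  refine Finset.prod_congr rfl fun i _ => ?_
  cases p i <;> cases y i <;> cases z i <;> simp [Pauli.mat]

/-- The Pauli group of `k` qubits: the unitaries `i ^ a P` with `P` a tensor product of Pauli
operators. -/
def pauliGroup (k : ℕ) : Subgroup (QU k) where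
  carrier := {V | ∃ (a : ℕ) (p : Fin k → Pauli), (V : Op k) = Complex.I ^ a • pauliString p}
  one_mem' := ⟨0, fun _ => Pauli.I, by simp [pauliString_one]⟩
  mul_mem' := by
    rintro V W ⟨a, p, hV⟩ ⟨b, q, hW⟩
    obtain ⟨c, r, h⟩ := pauliString_mul p q
    refine ⟨a + b + c, r, ?_⟩
    rw [Matrix.UnitaryGroup.mul_val, hV, hW, smul_mul_assoc, mul_smul_comm, h, smul_smul, smul_smul,
      pow_add, pow_add, mul_assoc]
  inv_mem' := by
    rintro V ⟨a, p, hV⟩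
    refine ⟨3 * a, p, ?_⟩
    rw [Matrix.UnitaryGroup.inv_val, hV, star_smul, pauliString_star, pow_mul]
    simp

/-- The Clifford group of `k` qubits: the unitaries that normalize the Pauli group. -/
def cliffordGroup (k : ℕ) : Subgroup (QU k) :=
  Subgroup.normalizer (pauliGroup k : Set (QU k))

/-- The global phases, as a subgroup of the Clifford group. -/
def phases (k : ℕ) : Subgroup (cliffordGroup k) where
  carrier := {V | ∃ c : ℂ, ((V : QU k) : Op k) = c • (1 : Op k)}
  one_mem' := ⟨1, by simp⟩
  mul_mem' := by
    rintro V W ⟨c, hV⟩ ⟨d, hW⟩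
    exact ⟨c * d, by simp [hV, hW, smul_smul, mul_comm]⟩
  inv_mem' := by
    rintro V ⟨c, hV⟩
    exact ⟨star c, by simp [hV]⟩

/-- Clifford unitaries up to a global phase. -/
abbrev Clifford (k : ℕ) : Type := cliffordGroup k ⧸ phases k

theorem pauliString_mul_self {n : ℕ} (p : Fin n → Pauli) :
    pauliString p * pauliString p = 1 := by
  rw [← pauliString_one]
  ext y z
  simp only [pauliString, Matrix.mul_apply, Matrix.of_apply, ← Finset.prod_mul_distrib]
  rw [← Fintype.piFinset_univ, ← Finset.prod_univ_sum (fun _ => Finset.univ)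
    (fun i b => (p i).mat (y i) b * (p i).mat b (z i))]
  refine Finset.prod_congr rfl fun i _ => ?_
  cases p i <;> cases y i <;> cases z i <;> simp [Pauli.mat]

theorem pauliString_mem {k : ℕ} (p : Fin k → Pauli) :
    pauliString p ∈ Matrix.unitaryGroup (Bits k) ℂ := by
  rw [Matrix.mem_unitaryGroup_iff, pauliString_star, pauliString_mul_self]

theorem eq_smul_one_of_commute {k : ℕ} (W : Op k)
    (h : ∀ p : Fin k → Pauli, W * pauliString p = pauliString p * W) :
    ∃ c : ℂ, W = c • (1 : Op k) := by
  have hz : ∀ i : Fin k, pauliString (Function.update (fun _ => Pauli.I) i Pauli.Z) =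
      Matrix.diagonal fun y : Bits k => if y i then (-1 : ℂ) else 1 := by
    intro i
    ext y z
    by_cases hyz : y = z
    · subst hyz
      simp only [pauliString, Matrix.of_apply, Matrix.diagonal_apply_eq]
      rw [Finset.prod_eq_single i]
      · simp [Pauli.mat]
      · intro j _ hj
        simp [Pauli.mat, Function.update_of_ne hj]
      · simp
    · rw [Matrix.diagonal_apply_ne _ hyz]
      obtain ⟨j, hj⟩ := Function.ne_iff.mp hyz
      refine Finset.prod_eq_zero (Finset.mem_univ j) ?_
      by_cases hji : j = i
      · subst hji; simp [Pauli.mat, hj]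
      · simp [Pauli.mat, Function.update_of_ne hji, hj]
  have hx : ∀ x y z : Bits k, pauliString (fun i => if x i then Pauli.X else Pauli.I) y z =
      if y = fun i => xor (z i) (x i) then 1 else 0 := by
    intro x y z
    split_ifs with hyz
    · subst hyz
      simp only [pauliString, Matrix.of_apply]
      refine Finset.prod_eq_one fun i _ => ?_
      cases hxi : x i <;> cases hzi : z i <;> simp [Pauli.mat]
    · obtain ⟨j, hj⟩ := Function.ne_iff.mp hyz
      refine Finset.prod_eq_zero (Finset.mem_univ j) ?_
      revert hj
      cases hxj : x j <;> cases hzj : z j <;> cases hyj : y j <;> simp [Pauli.mat, hxj]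
  refine ⟨W (fun _ => false) (fun _ => false), ?_⟩
  ext y z
  by_cases hyz : y = z
  · subst hyz
    have := congrFun (congrFun (h fun i => if y i then Pauli.X else Pauli.I) fun _ => false) y
    simp only [Matrix.mul_apply, hx] at this
    have e : ∀ w : Bits k, ((fun _ => false) = fun i => xor (w i) (y i)) ↔ w = y := by
      intro w
      simp only [funext_iff]
      refine forall_congr' fun i => ?_
      cases w i <;> cases y i <;> simp
    simpa [e] using this.symm
  · obtain ⟨i, hi⟩ := Function.ne_iff.mp hyz
    have := congrFun (congrFun (h (Function.update (fun _ => Pauli.I) i Pauli.Z)) y) z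
    rw [hz, Matrix.mul_diagonal, Matrix.diagonal_mul] at this
    have h0 : W y z = 0 := by
      revert hi this
      cases y i <;> cases z i <;> simp <;> intro h1
      · linear_combination (-1 / 2 : ℂ) * h1
      · linear_combination (1 / 2 : ℂ) * h1
    simp [h0, hyz]

instance instFiniteClifford (k : ℕ) : Finite (Clifford k) := by
  let T : Set (Op k) := {M | ∃ (a : ℕ) (p : Fin k → Pauli), M = Complex.I ^ a • pauliString p}
  have hT : T.Finite := by
    refine (Set.finite_range fun x : Fin 4 × (Fin k → Pauli) =>
      Complex.I ^ (x.1 : ℕ) • pauliString x.2).subset ?_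
    rintro M ⟨a, p, rfl⟩
    exact ⟨(⟨a % 4, Nat.mod_lt _ (by norm_num)⟩, p), by simp [← Complex.I_pow_eq_pow_mod]⟩
  have := hT.to_subtype
  have hmem : ∀ (V : cliffordGroup k) (p : Fin k → Pauli),
      ((V : QU k) : Op k) * pauliString p * star ((V : QU k) : Op k) ∈ T := by
    intro V p
    have := (Subgroup.mem_normalizer_iff.mp V.2 ⟨pauliString p, pauliString_mem p⟩).mp
      ⟨0, p, by simp⟩
    exact this
  refine Finite.of_injective
    (fun (g : Clifford k) (p : Fin k → Pauli) => (⟨_, hmem g.out p⟩ : T)) fun g g' hg => ?_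
  have hphase : g.out⁻¹ * g'.out ∈ phases k := by
    have hcomm := eq_smul_one_of_commute
      (star ((g.out : QU k) : Op k) * ((g'.out : QU k) : Op k)) fun p => by
        have hp := congrArg Subtype.val (congrFun hg p)
        simp only at hp
        have h1 := Matrix.UnitaryGroup.star_mul_self (g.out : QU k)
        have h2 := Matrix.UnitaryGroup.star_mul_self (g'.out : QU k)
        calc star ((g.out : QU k) : Op k) * ((g'.out : QU k) : Op k) * pauliString p
            = star ((g.out : QU k) : Op k) * (((g'.out : QU k) : Op k) * pauliString p *
                star ((g'.out : QU k) : Op k)) * ((g'.out : QU k) : Op k) := by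
              simp only [Matrix.mul_assoc, h2, Matrix.mul_one]
          _ = pauliString p * (star ((g.out : QU k) : Op k) * ((g'.out : QU k) : Op k)) := by
              rw [← hp]
              simp only [← Matrix.mul_assoc, h1, Matrix.one_mul]
    simpa [phases] using hcomm
  rw [← QuotientGroup.out_eq' g, ← QuotientGroup.out_eq' g']
  exact QuotientGroup.eq.mpr hphase

instance instFintypeClifford (k : ℕ) : Fintype (Clifford k) := Fintype.ofFinite _

/-! ### Circuits -/

/-- The `k`-qubit operator `V`, applied to the qubits `e 0, …, e (k - 1)` out of `n` qubits and
tensored with the identity on all other qubits. -/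
def applyGate {k n : ℕ} (e : Fin k ↪ Fin n) (V : Op k) : Op n :=
  Matrix.of fun y z =>
    if ∀ i, i ∉ Set.range e → y i = z i then V (fun j => y (e j)) (fun j => z (e j)) else 0

/-- The circuit `V_{m-1} ⋯ V_1 V_0` (gate `0` is applied first), in which the `j`-th gate acts on
the qubits in the support `e j`. -/
def circuit {k n m : ℕ} (e : Fin m → (Fin k ↪ Fin n)) (V : Fin m → QU k) : Op n :=
  (List.ofFn fun j => applyGate (e j) (V j : Op k)).reverse.prod

/-- `|0ⁿ⟩⟨0ⁿ|`. -/
def zeroState (n : ℕ) : Op n := Matrix.single (fun _ => false) (fun _ => false) 1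

/-- `⟨0ⁿ| M |0ⁿ⟩`. -/
def zeroExpect {n : ℕ} (M : Op n) : ℂ := M (fun _ => false) (fun _ => false)

/-- The projector `|x⟩⟨x|` on the qubits in `Q`, tensored with the identity on the others. -/
def proj {n : ℕ} (Q : Finset (Fin n)) (x : Q → Bool) : Op n :=
  Matrix.diagonal fun y => if ∀ i : Q, y i = x i then 1 else 0

/-- The partial trace over all qubits except the qubit `a`. -/
def reduceTo {n : ℕ} (a : Fin n) (M : Op n) : Matrix Bool Bool ℂ :=
  Matrix.of fun i j => ∑ y : Bits n, if y a = i then M y (Function.update y a j) else 0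

/-- `q(x)`, the probability that measuring the qubits in `B` of the state `U|0ⁿ⟩` in the
computational basis yields `x`. -/
def outcomeProb {n : ℕ} (B : Finset (Fin n)) (U : Op n) (x : B → Bool) : ℝ :=
  (zeroExpect (Uᴴ * proj B x * U)).re

/-- `ρ(x)`, the state of the qubit `a` after measuring the qubits in `B` of `U|0ⁿ⟩` with
outcome `x`. -/
def postState {n : ℕ} (a : Fin n) (B : Finset (Fin n)) (U : Op n) (x : B → Bool) :
    Matrix Bool Bool ℂ :=
  ((outcomeProb B U x : ℂ))⁻¹ • reduceTo a (proj B x * (U * zeroState n * Uᴴ) * proj B x)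

/-- The average of the purity `Tr ρ(x)²` over the measurement outcome `x ∼ q`. -/
def avgPurity {n : ℕ} (a : Fin n) (B : Finset (Fin n)) (U : Op n) : ℝ :=
  ∑ x : B → Bool, outcomeProb B U x * (Matrix.trace (postState a B U x ^ 2)).re

/-- `P_Q(0)`, the probability that measuring the qubits in `Q` of `U|0ⁿ⟩` yields all zeros. -/
def zeroProb {n : ℕ} (Q : Finset (Fin n)) (U : Op n) : ℝ :=
  outcomeProb Q U fun _ => false

/-! ### Entanglement-killing stabilizers -/

/-- `P_A ⊗ Z(r)_B ⊗ I_C`, where `A = {a}` and `C` consists of all qubits outside `A` and `B`. -/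
def killer {n : ℕ} (a : Fin n) (B : Finset (Fin n)) (P : Pauli) (r : B → Bool) : Op n :=
  pauliString fun i =>
    if i = a then P
    else if hi : i ∈ B then (if r ⟨i, hi⟩ then Pauli.Z else Pauli.I)
    else Pauli.I

/-- The set `S_P` of all `s` such that `D Z(s) D†` equals `± P_A ⊗ Z(r)_B ⊗ I_C` for some `r`. -/
def killSet {n : ℕ} (a : Fin n) (B : Finset (Fin n)) (D : Op n) (P : Pauli) : Set (Bits n) :=
  {s | ∃ (r : B → Bool) (α : Fin 2),
    D * zString s * Dᴴ = (-1 : ℂ) ^ (α : ℕ) • killer a B P r}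

/-- `S = S_X ∪ S_Y ∪ S_Z`. -/
def killSetAll {n : ℕ} (a : Fin n) (B : Finset (Fin n)) (D : Op n) : Set (Bits n) :=
  killSet a B D Pauli.X ∪ killSet a B D Pauli.Y ∪ killSet a B D Pauli.Z

/-! ### Averages over random circuits -/

/-- The law of the gates of the random circuit `U`: `m` independent Haar-random `k`-qubit
unitaries. -/
def haarGates (k m : ℕ) : Measure (Fin m → QU k) := Measure.pi fun _ => haarU k

/-- `E_D |S|`: the average of `|S|` over circuits whose gates are independent and uniformly random
Clifford unitaries up to phase. The set `S` does not depend on the phases of the gates. -/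
def expectedKillers {k n m : ℕ} (e : Fin m → (Fin k ↪ Fin n)) (a : Fin n) (B : Finset (Fin n)) :
    ℝ :=
  (∑ g : Fin m → Clifford k,
    ((killSetAll a B (circuit e fun j => ((g j).out : QU k))).ncard : ℝ)) /
    (Fintype.card (Fin m → Clifford k) : ℝ)

/-- The subsystem anticoncentration measure `χ = 4^|AB| E_U [P_AB(0)²] - 1`, where `A = {a}`. -/
def chi {k n m : ℕ} (e : Fin m → (Fin k ↪ Fin n)) (a : Fin n) (B : Finset (Fin n)) : ℝ :=
  4 ^ (insert a B).card *
    (∫ V, zeroProb (insert a B) (circuit e V) ^ 2 ∂(haarGates k m)) - 1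

end MIE

end

/-!
The argument compares both random circuits in the Heisenberg picture. A Pauli string `p` conjugated
by a gate `V` expands as `∑ q, pauliCoeff V p q • q`, and if the law of `V` is invariant under
multiplication by Clifford unitaries on both sides, then the second moments of these coefficients
are forced (`IsCliffordInvariant.integral_eq`): multiplying by Pauli strings kills the mixed
moments, and since the Clifford group acts transitively on the Pauli strings other than the
identity, the remaining ones are uniform. Haar-random gates and uniformly random Clifford gates
both satisfy this, so for either circuit the average of `⟨p⟩⟨p'⟩` in the output state is
`pairMoment`, which is computed by a Markov chain that starts at `(p, p')`, rerandomizes the support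
of one gate after another and is killed when the two strings disagree there.

For a Clifford circuit, `⟨p⟩²` is `1` if some `Z(s)` is mapped to `± p` and `0` otherwise, so `E|S|`
is the sum of the moments `pairMoment p p` over the strings `p = P_A ⊗ Z(r)_B` with `P ≠ I`
(`expectedKillers_eq`).

*Purity.* Let `t(x)` be the Bloch vector of the unnormalized state of `A` after outcome `x`. Its
length is at most `q(x)` by positivity, so the average purity is at most `1/2 + 1/2 ∑ x, |t(x)|`. The
Cauchy–Schwarz inequality over the `2^|B|` outcomes and Parseval's identity bound the sum by the
square root of `∑ P r, ⟨P_A ⊗ Z(r)_B⟩²` (`avgPurity_le`), and Jensen's inequality moves the average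
inside the root. This gives the first bound, even without the factor `3`.

*Anticoncentration.* The projector `|0⟩⟨0|_{AB}` is the average of the `Z`-strings on `A ∪ B`, so
`χ + 1` is a sum of pair moments, all of them nonnegative. Those of the identity and of the strings
`Z_A ⊗ Z(r)_B` already give `1 + ∑ r, pairMoment (Z_A Z(r)) (Z_A Z(r))` (`sum_pairMoment_le_chi`).
Finally, `P_A Z(r)` never has a larger moment than `Z_A Z(r)` (`pairMoment_le_update`), as a gate on
`A` forgets the operator `P`, and without such a gate only `P = Z` contributes. So `E|S|` is at most
three times that sum.
-/

noncomputable section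

namespace MIE

open Kronecker

/-! ### Pauli strings: commutation signs, orthogonality and completeness -/

/-- The sign `±1` by which two single-qubit Pauli operators commute. -/
def Pauli.comm (P Q : Pauli) : ℤ := if P = Pauli.I ∨ Q = Pauli.I ∨ P = Q then 1 else -1

/-- The sign `±1` by which two Pauli strings commute. -/
def commSign {n : ℕ} (p q : Fin n → Pauli) : ℤ := ∏ i, (p i).comm (q i)

theorem commSign_eq_or {n : ℕ} (p q : Fin n → Pauli) : commSign p q = 1 ∨ commSign p q = -1 := by
  refine Finset.prod_induction _ (fun a : ℤ => a = 1 ∨ a = -1) ?_ (Or.inl rfl) ?_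
  · rintro a b (rfl | rfl) (rfl | rfl) <;> simp
  · intro i _
    unfold Pauli.comm
    split_ifs <;> simp

theorem Pauli.comm_symm (P Q : Pauli) : P.comm Q = Q.comm P := by
  revert P Q; decide

theorem commSign_symm {n : ℕ} (p q : Fin n → Pauli) : commSign p q = commSign q p :=
  Finset.prod_congr rfl fun _ _ => Pauli.comm_symm _ _

theorem Pauli.mat_mul_comm (P Q : Pauli) (y z : Bool) :
    ∑ b, P.mat y b * Q.mat b z = (P.comm Q : ℂ) * ∑ b, Q.mat y b * P.mat b z := by
  cases P <;> cases Q <;> cases y <;> cases z <;> simp [Pauli.mat, Pauli.comm]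

theorem pauliString_mul_apply {n : ℕ} (p q : Fin n → Pauli) (y z : Bits n) :
    (pauliString p * pauliString q) y z = ∏ i, ∑ b, (p i).mat (y i) b * (q i).mat b (z i) := by
  simp only [pauliString, Matrix.mul_apply, Matrix.of_apply, ← Finset.prod_mul_distrib]
  rw [Finset.prod_univ_sum, Fintype.piFinset_univ]

theorem pauliString_mul_comm {n : ℕ} (p q : Fin n → Pauli) :
    pauliString p * pauliString q = (commSign p q : ℂ) • (pauliString q * pauliString p) := by
  ext y z
  rw [Matrix.smul_apply, pauliString_mul_apply, pauliString_mul_apply, commSign, smul_eq_mul,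
    Int.cast_prod, ← Finset.prod_mul_distrib]
  exact Finset.prod_congr rfl fun i _ => Pauli.mat_mul_comm _ _ _ _

/-- Conjugating a Pauli string by another one multiplies it by their commutation sign. -/
theorem pauliString_conj {n : ℕ} (p q : Fin n → Pauli) :
    pauliString p * pauliString q * pauliString p = (commSign p q : ℂ) • pauliString q := by
  rw [pauliString_mul_comm, smul_mul_assoc, Matrix.mul_assoc, pauliString_mul_self, Matrix.mul_one]

theorem Pauli.trace_mul (P Q : Pauli) :
    ∑ y, ∑ b, P.mat y b * Q.mat b y = if P = Q then 2 else 0 := by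
  cases P <;> cases Q <;> simp [Pauli.mat] <;> norm_num

theorem trace_pauliString_mul {n : ℕ} (p q : Fin n → Pauli) :
    Matrix.trace (pauliString p * pauliString q) = if p = q then 2 ^ n else 0 := by
  simp only [Matrix.trace, Matrix.diag_apply, pauliString_mul_apply]
  rw [← Fintype.piFinset_univ, ← Finset.prod_univ_sum (fun _ => Finset.univ)
    (fun i y => ∑ b, (p i).mat y b * (q i).mat b y)]
  simp only [Pauli.trace_mul]
  split_ifs with h
  · simp [h]
  · obtain ⟨i, hi⟩ := Function.ne_iff.mp h
    exact Finset.prod_eq_zero (Finset.mem_univ i) (by simp [hi])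

theorem trace_pauliString {n : ℕ} (p : Fin n → Pauli) :
    Matrix.trace (pauliString p) = if p = fun _ => Pauli.I then 2 ^ n else 0 := by
  rw [← trace_pauliString_mul, pauliString_one, Matrix.mul_one]

/-- Two Pauli strings that agree up to a nonzero factor are equal. -/
theorem eq_of_pauliString_eq_smul {n : ℕ} {p q : Fin n → Pauli} {c : ℂ}
    (h : pauliString p = c • pauliString q) : p = q := by
  by_contra hpq
  have h1 := trace_pauliString_mul p p
  nth_rewrite 2 [h] at h1
  rw [mul_smul_comm, Matrix.trace_smul, trace_pauliString_mul, if_neg hpq, if_pos rfl,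
    smul_zero] at h1
  exact pow_ne_zero n two_ne_zero h1.symm

theorem Pauli.sum_mat_mul_mat (a b c d : Bool) :
    ∑ P : Pauli, P.mat a b * P.mat c d = if a = d ∧ b = c then 2 else 0 := by
  have h : (Finset.univ : Finset Pauli) = {Pauli.I, Pauli.X, Pauli.Y, Pauli.Z} := rfl
  rw [h]
  cases a <;> cases b <;> cases c <;> cases d <;> simp [Pauli.mat] <;> norm_num

theorem sum_pauliString_mul_pauliString {n : ℕ} (y z y' z' : Bits n) :
    ∑ p, pauliString p y z * pauliString p y' z' = if y = z' ∧ z = y' then 2 ^ n else 0 := by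
  simp only [pauliString, Matrix.of_apply, ← Finset.prod_mul_distrib]
  rw [← Fintype.piFinset_univ, ← Finset.prod_univ_sum (fun _ => Finset.univ)
    (fun i (P : Pauli) => P.mat (y i) (z i) * P.mat (y' i) (z' i))]
  simp only [Pauli.sum_mat_mul_mat]
  split_ifs with h
  · simp [h.1, h.2]
  · by_cases h1 : y = z'
    · obtain ⟨i, hi⟩ := Function.ne_iff.mp fun h2 => h ⟨h1, h2⟩
      exact Finset.prod_eq_zero (Finset.mem_univ i) (by simp [hi])
    · obtain ⟨i, hi⟩ := Function.ne_iff.mp h1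
      exact Finset.prod_eq_zero (Finset.mem_univ i) (by simp [hi])

/-- The expansion of an operator in the Pauli basis. -/
theorem sum_trace_smul_pauliString {n : ℕ} (M : Op n) :
    ∑ q, Matrix.trace (pauliString q * M) • pauliString q = (2 ^ n : ℂ) • M := by
  ext y z
  simp only [Matrix.sum_apply, Matrix.smul_apply, smul_eq_mul, Matrix.trace, Matrix.diag_apply,
    Matrix.mul_apply, Finset.sum_mul]
  rw [Finset.sum_comm]
  simp_rw [Finset.sum_comm (s := (Finset.univ : Finset (Fin n → Pauli)))]
  have h : ∀ u v : Bits n, ∑ q, pauliString q u v * M v u * pauliString q y z =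
      (if u = z ∧ v = y then 2 ^ n else 0) * M v u := fun u v => by
    rw [← sum_pauliString_mul_pauliString u v y z, Finset.sum_mul]
    exact Finset.sum_congr rfl fun q _ => by ring
  simp_rw [h]
  rw [Finset.sum_eq_single z, Finset.sum_eq_single y]
  · simp
  · intro v _ hv
    simp [hv]
  · simp
  · intro u _ hu
    simp [hu]
  · simp

/-- Distinct Pauli strings are told apart by their commutation signs with some Pauli string. -/
theorem exists_commSign_ne {n : ℕ} {p q : Fin n → Pauli} (h : p ≠ q) :
    ∃ r : Fin n → Pauli, commSign r p * commSign r q = -1 := by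
  obtain ⟨i, hi⟩ := Function.ne_iff.mp h
  have key : ∀ P Q : Pauli, P ≠ Q → ∃ R : Pauli, R.comm P * R.comm Q = -1 := by decide
  obtain ⟨R, hR⟩ := key _ _ hi
  refine ⟨Function.update (fun _ => Pauli.I) i R, ?_⟩
  rw [commSign, commSign, ← Finset.prod_mul_distrib, Finset.prod_eq_single i]
  · simpa using hR
  · intro j _ hj
    simp [Function.update_of_ne hj, Pauli.comm]
  · simp

/-- Two Pauli strings other than the identity have a common anticommuting Pauli string. -/
theorem exists_commSign_eq_neg_one {n : ℕ} {p q : Fin n → Pauli} (hp : p ≠ fun _ => Pauli.I)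
    (hq : q ≠ fun _ => Pauli.I) :
    ∃ r : Fin n → Pauli, commSign r p = -1 ∧ commSign r q = -1 := by
  have key1 : ∀ P : Pauli, P ≠ Pauli.I → ∃ R : Pauli, R.comm P = -1 := by decide
  have key2 : ∀ P Q : Pauli, P ≠ Pauli.I → Q ≠ Pauli.I →
    ∃ R : Pauli, R.comm P = -1 ∧ R.comm Q = -1 := by decide
  have single : ∀ (p : Fin n → Pauli) (i : Fin n) (R : Pauli),
      commSign (Function.update (fun _ => Pauli.I) i R) p = R.comm (p i) := by
    intro p i R
    rw [commSign, Finset.prod_eq_single i]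
    · simp
    · intro j _ hj
      simp [Function.update_of_ne hj, Pauli.comm]
    · simp
  by_cases hpq : ∃ i, p i ≠ Pauli.I ∧ q i ≠ Pauli.I
  · obtain ⟨i, hi, hi'⟩ := hpq
    obtain ⟨R, hR, hR'⟩ := key2 _ _ hi hi'
    exact ⟨Function.update (fun _ => Pauli.I) i R, by rw [single, hR], by rw [single, hR']⟩
  · push Not at hpq
    obtain ⟨i, hi⟩ := Function.ne_iff.mp hp
    obtain ⟨j, hj⟩ := Function.ne_iff.mp hq
    have hqi := hpq i hi
    have hpj : p j = Pauli.I := by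
      by_contra h
      exact hj (hpq j h)
    have hij : j ≠ i := by
      rintro rfl
      exact hi hpj
    obtain ⟨R, hR⟩ := key1 _ hi
    obtain ⟨R', hR'⟩ := key1 _ hj
    have two : ∀ s : Fin n → Pauli,
        commSign (Function.update (Function.update (fun _ => Pauli.I) i R) j R') s =
          R.comm (s i) * R'.comm (s j) := by
      intro s
      have h1 : ∀ l, l ≠ i ∧ l ≠ j →
          (Function.update (Function.update (fun _ => Pauli.I) i R) j R' l).comm (s l) = 1 := by
        rintro l ⟨hli, hlj⟩
        simp [Function.update_of_ne hli, Function.update_of_ne hlj, Pauli.comm]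
      rw [commSign, Fintype.prod_eq_mul i j hij.symm h1]
      simp [Function.update_of_ne hij.symm]
    have hI : ∀ P : Pauli, P.comm Pauli.I = 1 := by decide
    refine ⟨_, (two p).trans ?_, (two q).trans ?_⟩
    · rw [hR, hpj, hI, mul_one]
    · rw [hR', hqi, hI, one_mul]

/-- The conjugate of a Pauli string by a Clifford unitary is a Pauli string up to a phase. -/
theorem clifford_conj {k : ℕ} {V : QU k} (hV : V ∈ cliffordGroup k) (p : Fin k → Pauli) :
    ∃ (a : ℕ) (q : Fin k → Pauli),
      (V : Op k)ᴴ * pauliString p * (V : Op k) = Complex.I ^ a • pauliString q := by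
  have := (Subgroup.mem_normalizer_iff.mp (inv_mem hV) ⟨pauliString p, pauliString_mem p⟩).mp
      ⟨0, p, by simp⟩
  obtain ⟨a, q, h⟩ := this
  refine ⟨a, q, ?_⟩
  rw [← h]
  simp [Matrix.star_eq_conjTranspose]

theorem pauliElement_mem_cliffordGroup {k : ℕ} (p : Fin k → Pauli) :
    (⟨pauliString p, pauliString_mem p⟩ : QU k) ∈ cliffordGroup k :=
  Subgroup.le_normalizer ⟨0, p, by simp⟩

/-- For anticommuting Pauli strings `Q`, `Q'` the unitary `(Q + Q') / √2` is a Clifford unitary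
that exchanges `Q` and `Q'`. -/
theorem exists_clifford_conj_of_anticommute {k : ℕ} {p q : Fin k → Pauli}
    (h : commSign p q = -1) :
    ∃ V ∈ cliffordGroup k, (V : Op k) * pauliString p * (V : Op k)ᴴ = pauliString q := by
  set P := pauliString p with hPdef
  set Q := pauliString q with hQdef
  have hPP : P * P = 1 := pauliString_mul_self p
  have hQQ : Q * Q = 1 := pauliString_mul_self q
  have hQP : Q * P = -(P * Q) := by
    have := pauliString_mul_comm q p
    rw [commSign_symm, h] at this
    simpa using this
  set r : ℂ := ((Real.sqrt 2 : ℝ) : ℂ)⁻¹ with hr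
  have hrr : r * r = 1 / 2 := by
    rw [hr, ← mul_inv, ← Complex.ofReal_mul, Real.mul_self_sqrt (by norm_num)]
    norm_num
  have hrs : star r = r := by
    rw [hr, star_inv₀]
    simp
  set W : Op k := r • (P + Q) with hW
  have hWs : Wᴴ = W := by
    rw [hW, Matrix.conjTranspose_smul, hrs, Matrix.conjTranspose_add]
    rw [← Matrix.star_eq_conjTranspose, ← Matrix.star_eq_conjTranspose, pauliString_star,
      pauliString_star]
  -- all conjugations by `W` reduce to words in `P`, `Q` and the conjugated operator
  have hconj : ∀ M : Op k, W * M * W = (1 / 2 : ℂ) • ((P + Q) * M * (P + Q)) := fun M => by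
    rw [hW, smul_mul_assoc, smul_mul_assoc, mul_smul_comm, smul_smul, hrr]
  have hWW : W * W = 1 := by
    have := hconj 1
    rw [Matrix.mul_one, Matrix.mul_one, Matrix.add_mul, Matrix.mul_add, Matrix.mul_add, hPP, hQQ,
      hQP] at this
    rw [this]
    ext i j
    simp
    ring
  have hmem : W ∈ Matrix.unitaryGroup (Bits k) ℂ := by
    rw [Matrix.mem_unitaryGroup_iff, Matrix.star_eq_conjTranspose, hWs, hWW]
  refine ⟨⟨W, hmem⟩, ?_, ?_⟩
  · have fwd : ∀ M : QU k, M ∈ pauliGroup k →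
        ⟨W, hmem⟩ * M * (⟨W, hmem⟩ : QU k)⁻¹ ∈ pauliGroup k := by
      rintro M ⟨a, s, hM⟩
      obtain ⟨b, t, ht⟩ := pauliString_mul p q
      obtain ⟨b', t', ht'⟩ := pauliString_mul s t
      have hval : ((⟨W, hmem⟩ * M * (⟨W, hmem⟩ : QU k)⁻¹ : QU k) : Op k) =
          Complex.I ^ a • ((1 / 2 : ℂ) • ((P + Q) * pauliString s * (P + Q))) := by
        rw [← hconj]
        simp only [Matrix.UnitaryGroup.mul_val, Matrix.UnitaryGroup.inv_val, hM,
          Matrix.star_eq_conjTranspose, hWs, mul_smul_comm, smul_mul_assoc]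
      have hPs := pauliString_mul_comm p s
      have hQs := pauliString_mul_comm q s
      rw [← hPdef] at hPs
      rw [← hQdef] at hQs
      have expand : ∀ u v : ℂ, P * pauliString s = u • (pauliString s * P) →
          Q * pauliString s = v • (pauliString s * Q) →
          (P + Q) * pauliString s * (P + Q) =
            (u + v) • pauliString s + (u - v) • (pauliString s * (P * Q)) := by
        intro u v hu hv
        have e1 : pauliString s * P * P = pauliString s := by
          rw [Matrix.mul_assoc, hPP, Matrix.mul_one]
        have e2 : pauliString s * Q * Q = pauliString s := by
          rw [Matrix.mul_assoc, hQQ, Matrix.mul_one]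
        have e3 : pauliString s * Q * P = -(pauliString s * (P * Q)) := by
          rw [Matrix.mul_assoc, hQP, Matrix.mul_neg]
        rw [Matrix.add_mul, hu, hv, Matrix.add_mul, Matrix.mul_add, Matrix.mul_add]
        simp only [smul_mul_assoc, e1, e2, e3]
        rw [Matrix.mul_assoc]
        module
      have hst : pauliString s * (P * Q) = Complex.I ^ (b + b') • pauliString t' := by
        rw [ht, mul_smul_comm, ht', smul_smul, pow_add]
      -- equal signs give `± s`, different signs give `± s P Q`
      rcases commSign_eq_or p s with hp | hp <;> rcases commSign_eq_or q s with hq | hq <;>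
        rw [hp] at hPs <;> rw [hq] at hQs <;> rw [expand _ _ hPs hQs] at hval
      · refine ⟨a, s, hval.trans ?_⟩
        push_cast
        module
      · refine ⟨a + (b + b'), t', hval.trans ?_⟩
        rw [pow_add, ← smul_smul, ← hst]
        push_cast
        module
      · refine ⟨a + 2 + (b + b'), t', hval.trans ?_⟩
        rw [pow_add, ← smul_smul, ← hst, pow_add, Complex.I_sq]
        push_cast
        module
      · refine ⟨a + 2, s, hval.trans ?_⟩
        rw [pow_add, Complex.I_sq]
        push_cast
        module
    have hinv : (⟨W, hmem⟩ : QU k)⁻¹ = ⟨W, hmem⟩ := by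
      ext1
      rw [Matrix.UnitaryGroup.inv_val, Matrix.star_eq_conjTranspose, hWs]
    refine Subgroup.mem_normalizer_iff.mpr fun M => ⟨fwd M, fun hM => ?_⟩
    have := fwd _ hM
    rw [hinv] at this
    have hWW' : (⟨W, hmem⟩ : QU k) * ⟨W, hmem⟩ = 1 :=
      Subtype.ext hWW
    have e : (⟨W, hmem⟩ : QU k) * (⟨W, hmem⟩ * M * ⟨W, hmem⟩) * ⟨W, hmem⟩ = M := by
      calc _ = (⟨W, hmem⟩ * ⟨W, hmem⟩ : QU k) * M * (⟨W, hmem⟩ * ⟨W, hmem⟩) := by group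
        _ = M := by rw [hWW', one_mul, mul_one]
    rwa [e] at this
  · change W * P * Wᴴ = Q
    have e1 : P * Q * P = -Q := by
      rw [Matrix.mul_assoc, hQP, Matrix.mul_neg, ← Matrix.mul_assoc, hPP, Matrix.one_mul]
    have e2 : P * Q * Q = P := by rw [Matrix.mul_assoc, hQQ, Matrix.mul_one]
    rw [hWs, hconj, Matrix.add_mul, hPP, hQP, Matrix.add_mul, Matrix.one_mul, Matrix.mul_add,
      Matrix.neg_mul, Matrix.neg_mul, e1, e2]
    module

/-- The Clifford group acts transitively on the Pauli strings other than the identity. -/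
theorem exists_clifford_conj {k : ℕ} {p q : Fin k → Pauli} (hp : p ≠ fun _ => Pauli.I)
    (hq : q ≠ fun _ => Pauli.I) :
    ∃ V ∈ cliffordGroup k, (V : Op k) * pauliString p * (V : Op k)ᴴ = pauliString q := by
  obtain ⟨r, h1, h2⟩ := exists_commSign_eq_neg_one hp hq
  rw [commSign_symm] at h1
  obtain ⟨V, hV, hVp⟩ := exists_clifford_conj_of_anticommute h1
  obtain ⟨W, hW, hWr⟩ := exists_clifford_conj_of_anticommute h2
  refine ⟨W * V, mul_mem hW hV, ?_⟩
  rw [Matrix.UnitaryGroup.mul_val, Matrix.conjTranspose_mul, ← hWr, ← hVp]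
  simp only [Matrix.mul_assoc]

/-! ### Second moments of conjugated Pauli strings -/

/-- The coefficient of the Pauli string `q` in the Pauli expansion of `V† p V`. -/
def pauliCoeff {k : ℕ} (V : QU k) (p q : Fin k → Pauli) : ℝ :=
  (Matrix.trace (pauliString q * ((V : Op k)ᴴ * pauliString p * (V : Op k)))).re / 2 ^ k

theorem pauliString_conjTranspose {n : ℕ} (p : Fin n → Pauli) :
    (pauliString p)ᴴ = pauliString p := by
  rw [← Matrix.star_eq_conjTranspose, pauliString_star]

theorem QU.conjTranspose_mul_self {k : ℕ} (V : QU k) : (V : Op k)ᴴ * (V : Op k) = 1 :=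
  Matrix.UnitaryGroup.star_mul_self V

theorem QU.mul_conjTranspose_self {k : ℕ} (V : QU k) : (V : Op k) * (V : Op k)ᴴ = 1 :=
  Matrix.mem_unitaryGroup_iff.mp V.2

theorem ofReal_pauliCoeff {k : ℕ} (V : QU k) (p q : Fin k → Pauli) :
    (pauliCoeff V p q : ℂ) =
      Matrix.trace (pauliString q * ((V : Op k)ᴴ * pauliString p * (V : Op k))) / 2 ^ k := by
  set t := Matrix.trace (pauliString q * ((V : Op k)ᴴ * pauliString p * (V : Op k))) with ht
  have h : conj t = t := by
    rw [starRingEnd_apply, ht, ← Matrix.trace_conjTranspose, Matrix.conjTranspose_mul,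
      Matrix.trace_mul_comm]
    simp only [Matrix.conjTranspose_mul, Matrix.conjTranspose_conjTranspose,
      pauliString_conjTranspose, Matrix.mul_assoc]
  have h2 : (t.re : ℂ) = t := Complex.conj_eq_iff_re.mp h
  rw [pauliCoeff, ← ht]
  push_cast
  rw [h2]

theorem conj_pauliString_eq_sum {k : ℕ} (V : QU k) (p : Fin k → Pauli) :
    (V : Op k)ᴴ * pauliString p * (V : Op k) =
      ∑ q, (pauliCoeff V p q : ℂ) • pauliString q := by
  have h := sum_trace_smul_pauliString ((V : Op k)ᴴ * pauliString p * (V : Op k))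
  have h2 : (2 ^ k : ℂ) ≠ 0 := pow_ne_zero k two_ne_zero
  rw [← inv_smul_eq_iff₀ h2] at h
  rw [← h, Finset.smul_sum]
  refine Finset.sum_congr rfl fun q _ => ?_
  rw [smul_smul, ofReal_pauliCoeff, div_eq_inv_mul]

theorem sum_pauliCoeff_sq {k : ℕ} (V : QU k) (p : Fin k → Pauli) :
    ∑ q, pauliCoeff V p q ^ 2 = 1 := by
  set M := (V : Op k)ᴴ * pauliString p * (V : Op k) with hM
  have hMM : M * M = 1 := by
    calc M * M = (V : Op k)ᴴ * pauliString p * ((V : Op k) * (V : Op k)ᴴ) * pauliString p *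
          (V : Op k) := by simp only [hM, Matrix.mul_assoc]
      _ = (V : Op k)ᴴ * (pauliString p * pauliString p) * (V : Op k) := by
          rw [QU.mul_conjTranspose_self]
          simp only [Matrix.mul_one, Matrix.mul_assoc]
      _ = 1 := by rw [pauliString_mul_self, Matrix.mul_one, QU.conjTranspose_mul_self]
  have h2 : (2 ^ k : ℂ) ≠ 0 := pow_ne_zero k two_ne_zero
  have h : Matrix.trace (M * M) = ∑ q, (pauliCoeff V p q : ℂ) * (2 ^ k * pauliCoeff V p q) := by
    nth_rewrite 1 [hM]
    rw [conj_pauliString_eq_sum, Finset.sum_mul, Matrix.trace_sum]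
    refine Finset.sum_congr rfl fun q _ => ?_
    rw [smul_mul_assoc, Matrix.trace_smul, smul_eq_mul, ofReal_pauliCoeff V p q, ← hM]
    field_simp
  rw [hMM, Matrix.trace_one, Fintype.card_fun, Fintype.card_bool, Fintype.card_fin] at h
  have h3 : (2 ^ k : ℂ) * ((∑ q, pauliCoeff V p q ^ 2 : ℝ) : ℂ) = 2 ^ k * 1 := by
    push_cast at h ⊢
    rw [mul_one]
    refine Eq.trans ?_ h.symm
    rw [Finset.mul_sum]
    exact Finset.sum_congr rfl fun q _ => by ring
  exact_mod_cast mul_left_cancel₀ h2 h3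

theorem pauliCoeff_one_left {k : ℕ} (V : QU k) (q : Fin k → Pauli) :
    pauliCoeff V (fun _ => Pauli.I) q = if q = fun _ => Pauli.I then 1 else 0 := by
  have h : (2 ^ k : ℂ) ≠ 0 := pow_ne_zero k two_ne_zero
  have := ofReal_pauliCoeff V (fun _ => Pauli.I) q
  rw [pauliString_one, Matrix.mul_one, QU.conjTranspose_mul_self, Matrix.mul_one,
    trace_pauliString] at this
  split_ifs with hq
  · rw [if_pos hq, div_self h] at this
    exact_mod_cast this
  · rw [if_neg hq, zero_div] at this
    exact_mod_cast this

theorem pauliCoeff_one_right {k : ℕ} (V : QU k) (p : Fin k → Pauli) :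
    pauliCoeff V p (fun _ => Pauli.I) = if p = fun _ => Pauli.I then 1 else 0 := by
  have h : (2 ^ k : ℂ) ≠ 0 := pow_ne_zero k two_ne_zero
  have := ofReal_pauliCoeff V p (fun _ => Pauli.I)
  rw [pauliString_one, Matrix.one_mul, Matrix.trace_mul_comm, ← Matrix.mul_assoc,
    QU.mul_conjTranspose_self, Matrix.one_mul, trace_pauliString] at this
  split_ifs with hq
  · rw [if_pos hq, div_self h] at this
    exact_mod_cast this
  · rw [if_neg hq, zero_div] at this
    exact_mod_cast this

/-- The element of the unitary group given by a Pauli string. -/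
def pauliU {k : ℕ} (p : Fin k → Pauli) : QU k := ⟨pauliString p, pauliString_mem p⟩

theorem pauliCoeff_pauliU_mul {k : ℕ} (r : Fin k → Pauli) (V : QU k) (p q : Fin k → Pauli) :
    pauliCoeff (pauliU r * V) p q = commSign r p * pauliCoeff V p q := by
  have h : ((pauliU r * V : QU k) : Op k)ᴴ * pauliString p * ((pauliU r * V : QU k) : Op k) =
      (commSign r p : ℂ) • ((V : Op k)ᴴ * pauliString p * (V : Op k)) := by
    calc _ = (V : Op k)ᴴ * (pauliString r * pauliString p * pauliString r) * (V : Op k) := by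
          rw [Matrix.UnitaryGroup.mul_val, Matrix.conjTranspose_mul]
          simp only [pauliU, pauliString_conjTranspose, Matrix.mul_assoc]
      _ = _ := by rw [pauliString_conj, mul_smul_comm, smul_mul_assoc]
  have := ofReal_pauliCoeff (pauliU r * V) p q
  rw [h, mul_smul_comm, Matrix.trace_smul, smul_eq_mul, mul_div_assoc, ← ofReal_pauliCoeff] at this
  exact_mod_cast this

/-- Right multiplication of `V` by `W` moves the coefficient of `q` to that of `W q W†`. -/
theorem pauliCoeff_mul_right {k : ℕ} (V W : QU k) (p q q' : Fin k → Pauli) (c : ℝ)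
    (h : (W : Op k) * pauliString q * (W : Op k)ᴴ = (c : ℂ) • pauliString q') :
    pauliCoeff (V * W) p q = c * pauliCoeff V p q' := by
  have := ofReal_pauliCoeff (V * W) p q
  have e : Matrix.trace (pauliString q * (((V * W : QU k) : Op k)ᴴ * pauliString p *
      ((V * W : QU k) : Op k))) = Matrix.trace (((W : Op k) * pauliString q * (W : Op k)ᴴ) *
        ((V : Op k)ᴴ * pauliString p * (V : Op k))) := by
    rw [Matrix.mul_assoc (W : Op k), Matrix.mul_assoc (W : Op k),
      Matrix.trace_mul_comm (W : Op k)]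
    congr 1
    rw [Matrix.UnitaryGroup.mul_val, Matrix.conjTranspose_mul]
    simp only [Matrix.mul_assoc]
  rw [e, h, smul_mul_assoc, Matrix.trace_smul, smul_eq_mul, mul_div_assoc,
    ← ofReal_pauliCoeff] at this
  exact_mod_cast this

theorem pauliCoeff_mul_pauliU {k : ℕ} (V : QU k) (r p q : Fin k → Pauli) :
    pauliCoeff (V * pauliU r) p q = commSign r q * pauliCoeff V p q := by
  refine pauliCoeff_mul_right V (pauliU r) p q q _ ?_
  rw [pauliU, pauliString_conjTranspose, pauliString_conj]
  simp

theorem continuous_pauliCoeff {k : ℕ} (p q : Fin k → Pauli) :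
    Continuous fun V : QU k => pauliCoeff V p q := by
  have h : Continuous fun V : QU k => (V : Op k) := continuous_subtype_val
  unfold pauliCoeff
  refine (Complex.continuous_re.comp (Continuous.matrix_trace ?_)).div_const _
  exact continuous_const.matrix_mul
    ((h.matrix_conjTranspose.matrix_mul continuous_const).matrix_mul h)

/-- A law on the unitary group whose products of two Pauli coefficients have averages that do not
change when the unitary is multiplied by a Clifford unitary on either side. -/
structure IsCliffordInvariant {k : ℕ} (ν : Measure (QU k)) : Prop where
  mul_left : ∀ W ∈ cliffordGroup k, ∀ p q p' q' : Fin k → Pauli,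
    ∫ V, pauliCoeff (W * V) p q * pauliCoeff (W * V) p' q' ∂ν =
      ∫ V, pauliCoeff V p q * pauliCoeff V p' q' ∂ν
  mul_right : ∀ W ∈ cliffordGroup k, ∀ p q p' q' : Fin k → Pauli,
    ∫ V, pauliCoeff (V * W) p q * pauliCoeff (V * W) p' q' ∂ν =
      ∫ V, pauliCoeff V p q * pauliCoeff V p' q' ∂ν

instance instNonemptyPauli : Nonempty Pauli := ⟨Pauli.I⟩

/-- The second moment of `pauliCoeff V p q` under a two-design: the identity is fixed and every
other Pauli string is moved to a uniformly random one. -/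
def pauliWeight {k : ℕ} (p q : Fin k → Pauli) : ℝ :=
  if p = fun _ => Pauli.I then (if q = fun _ => Pauli.I then 1 else 0)
  else if q = fun _ => Pauli.I then 0 else 1 / ((Fintype.card (Fin k → Pauli) : ℝ) - 1)

theorem pauliWeight_nonneg {k : ℕ} (p q : Fin k → Pauli) : 0 ≤ pauliWeight p q := by
  have : (1 : ℝ) ≤ Fintype.card (Fin k → Pauli) := by
    exact_mod_cast (Fintype.card_pos (α := Fin k → Pauli))
  unfold pauliWeight
  split_ifs
  · exact zero_le_one
  · exact le_rfl
  · exact le_rfl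
  · exact div_nonneg zero_le_one (by linarith)

theorem integrable_of_continuous {X : Type*} [TopologicalSpace X] [CompactSpace X]
    [MeasurableSpace X] [BorelSpace X] (μ : Measure X) [IsFiniteMeasure μ] {f : X → ℝ}
    (hf : Continuous f) : Integrable f μ :=
  hf.integrable_of_hasCompactSupport (HasCompactSupport.of_compactSpace f)

/-- The second moments of the Pauli coefficients are those of a two-design. Pauli strings
multiplied from the left and the right make the mixed moments vanish, and the transitivity of the
Clifford group makes the others uniform. -/
theorem IsCliffordInvariant.integral_eq {k : ℕ} {ν : Measure (QU k)} [IsProbabilityMeasure ν]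
    (hν : IsCliffordInvariant ν) (p q p' q' : Fin k → Pauli) :
    ∫ V, pauliCoeff V p q * pauliCoeff V p' q' ∂ν =
      if p = p' ∧ q = q' then pauliWeight p q else 0 := by
  have neg : ∀ x : ℝ, x = -x → x = 0 := fun x hx => by linarith
  by_cases hp : p = p'
  swap
  · rw [if_neg fun h => hp h.1]
    obtain ⟨r, hr⟩ := exists_commSign_ne hp
    have hr' : (commSign r p : ℝ) * commSign r p' = -1 := by exact_mod_cast hr
    have h := hν.mul_left (pauliU r) (pauliElement_mem_cliffordGroup r) p q p' q'
    refine neg _ (h.symm.trans ?_)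
    rw [← integral_neg]
    refine integral_congr_ae (Filter.Eventually.of_forall fun V => ?_)
    simp only [pauliCoeff_pauliU_mul]
    linear_combination (pauliCoeff V p q * pauliCoeff V p' q') * hr'
  by_cases hq : q = q'
  swap
  · rw [if_neg fun h => hq h.2]
    obtain ⟨r, hr⟩ := exists_commSign_ne hq
    have hr' : (commSign r q : ℝ) * commSign r q' = -1 := by exact_mod_cast hr
    have h := hν.mul_right (pauliU r) (pauliElement_mem_cliffordGroup r) p q p' q'
    refine neg _ (h.symm.trans ?_)
    rw [← integral_neg]
    refine integral_congr_ae (Filter.Eventually.of_forall fun V => ?_)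
    simp only [pauliCoeff_mul_pauliU]
    linear_combination (pauliCoeff V p q * pauliCoeff V p' q') * hr'
  subst hp hq
  rw [if_pos ⟨rfl, rfl⟩, pauliWeight]
  by_cases hpI : p = fun _ => Pauli.I
  · rw [if_pos hpI]
    subst hpI
    simp only [pauliCoeff_one_left]
    split_ifs <;> simp
  rw [if_neg hpI]
  by_cases hqI : q = fun _ => Pauli.I
  · rw [if_pos hqI]
    subst hqI
    simp only [pauliCoeff_one_right, if_neg hpI]
    simp
  rw [if_neg hqI]
  have hconst : ∀ s : Fin k → Pauli, s ≠ (fun _ => Pauli.I) →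
      ∫ V, pauliCoeff V p s ^ 2 ∂ν = ∫ V, pauliCoeff V p q ^ 2 ∂ν := by
    intro s hs
    obtain ⟨W, hW, hWq⟩ := exists_clifford_conj hqI hs
    have h := hν.mul_right W hW p q p q
    have e : ∀ V, pauliCoeff (V * W) p q = pauliCoeff V p s := fun V => by
      rw [pauliCoeff_mul_right V W p q s 1 (by simpa using hWq), one_mul]
    simp only [e, ← pow_two] at h
    exact h
  have hI : ∫ V, pauliCoeff V p (fun _ => Pauli.I) ^ 2 ∂ν = 0 := by
    simp [pauliCoeff_one_right, hpI]
  have hsum : ∑ s, ∫ V, pauliCoeff V p s ^ 2 ∂ν = 1 := by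
    have h := integral_finsetSum (μ := ν) Finset.univ
      (f := fun s (V : QU k) => pauliCoeff V p s ^ 2) fun s _ =>
        integrable_of_continuous ν ((continuous_pauliCoeff p s).pow 2)
    rw [← h]
    simp [sum_pauliCoeff_sq]
  -- the moments of the strings other than the identity are equal and add up to `1`
  rw [← Finset.add_sum_erase _ _ (Finset.mem_univ fun _ : Fin k => Pauli.I), hI, zero_add,
    Finset.sum_congr rfl fun s hs => hconst s (Finset.ne_of_mem_erase hs), Finset.sum_const,
    Finset.card_erase_of_mem (Finset.mem_univ _), Finset.card_univ, nsmul_eq_mul,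
    Nat.cast_sub Fintype.card_pos, Nat.cast_one] at hsum
  simp only [← pow_two]
  exact eq_one_div_of_mul_eq_one_right hsum

/-! ### The Haar measure and the uniform law on Clifford unitaries -/

instance instIsMulRightInvariantHaarU (k : ℕ) : (haarU k).IsMulRightInvariant where
  map_mul_right_eq_self g := by
    have : (haarU k).IsHaarMeasure := by unfold haarU; infer_instance
    have : IsProbabilityMeasure (Measure.map (fun x => x * g) (haarU k)) :=
      Measure.isProbabilityMeasure_map (measurable_mul_const g).aemeasurable
    exact Measure.isHaarMeasure_eq_of_isProbabilityMeasure _ _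

theorem isCliffordInvariant_haarU (k : ℕ) : IsCliffordInvariant (haarU k) where
  mul_left W _ p q p' q' := by
    have : (haarU k).IsHaarMeasure := by unfold haarU; infer_instance
    exact integral_mul_left_eq_self (fun V => pauliCoeff V p q * pauliCoeff V p' q') W
  mul_right W _ p q p' q' :=
    integral_mul_right_eq_self (fun V => pauliCoeff V p q * pauliCoeff V p' q') W

/-- The law of `f i` for a uniformly random `i`. -/
def uniformLaw {ι X : Type*} [Fintype ι] [MeasurableSpace X] (f : ι → X) : Measure X :=
  (Fintype.card ι : ENNReal)⁻¹ • ∑ i, Measure.dirac (f i)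

theorem uniformLaw_apply {ι X : Type*} [Fintype ι] [MeasurableSpace X] (f : ι → X) {s : Set X}
    (hs : MeasurableSet s) :
    uniformLaw f s = ∑ i, (Fintype.card ι : ENNReal)⁻¹ * s.indicator 1 (f i) := by
  simp only [uniformLaw, Measure.smul_apply, Measure.finsetSum_apply, smul_eq_mul, Finset.mul_sum,
    Measure.dirac_apply' _ hs]

instance instIsProbabilityMeasureUniformLaw {ι X : Type*} [Fintype ι] [Nonempty ι]
    [MeasurableSpace X] (f : ι → X) : IsProbabilityMeasure (uniformLaw f) := by
  constructor
  rw [uniformLaw_apply f MeasurableSet.univ]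
  simp only [Set.indicator_univ, Pi.one_apply, mul_one, Finset.sum_const, Finset.card_univ,
    nsmul_eq_mul]
  exact ENNReal.mul_inv_cancel (by simp) (by simp)

theorem integral_uniformLaw {ι X : Type*} [Fintype ι] [TopologicalSpace X] [MeasurableSpace X]
    [BorelSpace X] (f : ι → X) {F : X → ℝ} (hF : Continuous F) :
    ∫ x, F x ∂(uniformLaw f) = (∑ i, F (f i)) / Fintype.card ι := by
  have hm := hF.stronglyMeasurable
  rw [uniformLaw, integral_smul_measure, integral_finsetSum_measure]
  · simp only [integral_dirac' F _ hm]
    simp [div_eq_inv_mul]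
  · intro i _
    exact (integrable_const (F (f i))).congr
      ((ae_dirac_iff (measurableSet_eq_fun measurable_const hF.measurable)).mpr rfl)

theorem pi_uniformLaw {ι X : Type*} [Fintype ι] [Nonempty ι] [MeasurableSpace X] (f : ι → X)
    (m : ℕ) :
    Measure.pi (fun _ : Fin m => uniformLaw f) =
      uniformLaw fun (g : Fin m → ι) j => f (g j) := by
  refine Measure.pi_eq fun s hs => ?_
  rw [uniformLaw_apply _ (MeasurableSet.univ_pi hs)]
  simp only [uniformLaw_apply f (hs _)]
  rw [Finset.prod_univ_sum, Fintype.piFinset_univ]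
  refine Finset.sum_congr rfl fun g _ => ?_
  rw [Finset.prod_mul_distrib]
  congr 1
  · rw [Fintype.card_fun, Finset.prod_const, Finset.card_univ, Nat.cast_pow, ENNReal.inv_pow]
  · classical
    simp only [Set.indicator_apply, Pi.one_apply, Set.mem_univ_pi, Finset.prod_ite_zero,
      Finset.prod_const_one, Finset.mem_univ, true_imp_iff]

instance instNormalPhases (k : ℕ) : (phases k).Normal where
  conj_mem := by
    rintro V ⟨c, hV⟩ W
    refine ⟨c, ?_⟩
    have h := QU.mul_conjTranspose_self (W : QU k)
    simp only [Subgroup.coe_mul, Subgroup.coe_inv, Matrix.UnitaryGroup.mul_val,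
      Matrix.UnitaryGroup.inv_val, hV, mul_smul_comm, Matrix.mul_one, smul_mul_assoc,
      Matrix.star_eq_conjTranspose, h]

theorem pauliCoeff_mul_phase {k : ℕ} (V : QU k) {W : cliffordGroup k} (hW : W ∈ phases k)
    (p q : Fin k → Pauli) : pauliCoeff (V * (W : QU k)) p q = pauliCoeff V p q := by
  obtain ⟨c, hc⟩ := hW
  have h := QU.mul_conjTranspose_self (W : QU k)
  rw [← one_mul (pauliCoeff V p q)]
  refine pauliCoeff_mul_right V W p q q 1 ?_
  rw [hc] at h ⊢
  simp only [smul_mul_assoc, Matrix.one_mul, Matrix.conjTranspose_smul, mul_smul_comm,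
    Matrix.conjTranspose_one, Matrix.mul_one] at h ⊢
  have h2 := congrArg (fun M => M * pauliString q) h
  simp only [smul_mul_assoc, Matrix.one_mul] at h2
  rw [h2]
  simp

/-- The Clifford unitary that represents a class of Clifford unitaries up to phase. -/
def cliffordOut {k : ℕ} (g : Clifford k) : QU k := (g.out : QU k)

theorem pauliCoeff_cliffordOut {k : ℕ} (V : cliffordGroup k) (p q : Fin k → Pauli) :
    pauliCoeff (cliffordOut (QuotientGroup.mk V : Clifford k)) p q =
      pauliCoeff (V : QU k) p q := by
  obtain ⟨W, hW⟩ := QuotientGroup.mk_out_eq_mul (phases k) V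
  rw [cliffordOut, hW, Subgroup.coe_mul, pauliCoeff_mul_phase _ W.2]

theorem sum_cliffordOut_mul_left {k : ℕ} (W : cliffordGroup k) (p q p' q' : Fin k → Pauli) :
    ∑ g : Clifford k, pauliCoeff ((W : QU k) * cliffordOut g) p q *
        pauliCoeff ((W : QU k) * cliffordOut g) p' q' =
      ∑ g : Clifford k, pauliCoeff (cliffordOut g) p q * pauliCoeff (cliffordOut g) p' q' := by
  have h : ∀ (g : Clifford k) (p q : Fin k → Pauli),
      pauliCoeff ((W : QU k) * cliffordOut g) p q =
        pauliCoeff (cliffordOut ((QuotientGroup.mk W : Clifford k) * g)) p q := fun g p q => by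
    have h1 := pauliCoeff_cliffordOut (W * g.out) p q
    rw [QuotientGroup.mk_mul, QuotientGroup.out_eq'] at h1
    exact h1.symm
  simp only [h]
  exact Equiv.sum_comp (Equiv.mulLeft (QuotientGroup.mk W : Clifford k))
    fun g => pauliCoeff (cliffordOut g) p q * pauliCoeff (cliffordOut g) p' q'

theorem sum_cliffordOut_mul_right {k : ℕ} (W : cliffordGroup k) (p q p' q' : Fin k → Pauli) :
    ∑ g : Clifford k, pauliCoeff (cliffordOut g * (W : QU k)) p q *
        pauliCoeff (cliffordOut g * (W : QU k)) p' q' =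
      ∑ g : Clifford k, pauliCoeff (cliffordOut g) p q * pauliCoeff (cliffordOut g) p' q' := by
  have h : ∀ (g : Clifford k) (p q : Fin k → Pauli),
      pauliCoeff (cliffordOut g * (W : QU k)) p q =
        pauliCoeff (cliffordOut (g * (QuotientGroup.mk W : Clifford k))) p q := fun g p q => by
    have h1 := pauliCoeff_cliffordOut (g.out * W) p q
    rw [QuotientGroup.mk_mul, QuotientGroup.out_eq'] at h1
    exact h1.symm
  simp only [h]
  exact Equiv.sum_comp (Equiv.mulRight (QuotientGroup.mk W : Clifford k))
    fun g => pauliCoeff (cliffordOut g) p q * pauliCoeff (cliffordOut g) p' q'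

theorem isCliffordInvariant_uniformLaw (k : ℕ) :
    IsCliffordInvariant (uniformLaw (cliffordOut (k := k))) where
  mul_left W hW p q p' q' := by
    have hc : Continuous fun V : QU k => pauliCoeff V p q * pauliCoeff V p' q' :=
      (continuous_pauliCoeff p q).mul (continuous_pauliCoeff p' q')
    rw [integral_uniformLaw _ hc]
    refine (integral_uniformLaw _ (hc.comp (continuous_const_mul W))).trans ?_
    exact congrArg (· / (Fintype.card (Clifford k) : ℝ))
      (sum_cliffordOut_mul_left ⟨W, hW⟩ p q p' q')
  mul_right W hW p q p' q' := by
    have hc : Continuous fun V : QU k => pauliCoeff V p q * pauliCoeff V p' q' :=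
      (continuous_pauliCoeff p q).mul (continuous_pauliCoeff p' q')
    rw [integral_uniformLaw _ hc]
    refine (integral_uniformLaw _ (hc.comp (continuous_mul_const W))).trans ?_
    exact congrArg (· / (Fintype.card (Clifford k) : ℝ))
      (sum_cliffordOut_mul_right ⟨W, hW⟩ p q p' q')

/-! ### Gates acting on some of the qubits -/

/-- The splitting of a bit string into its restrictions to the support of `e` and to the other
qubits. -/
def bitsSplit {k n : ℕ} (e : Fin k ↪ Fin n) :
    Bits n ≃ Bits k × ({i : Fin n // i ∉ Set.range e} → Bool) where
  toFun y := (fun j => y (e j), fun i => y i)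
  invFun u i := if h : i ∈ Set.range e then u.1 h.choose else u.2 ⟨i, h⟩
  left_inv y := by
    funext i
    by_cases h : i ∈ Set.range e
    · simp only [dif_pos h]
      rw [h.choose_spec]
    · simp only [dif_neg h]
  right_inv u := by
    refine Prod.ext (funext fun j => ?_) (funext fun i => ?_)
    · have h : e j ∈ Set.range e := ⟨j, rfl⟩
      simp only [dif_pos h]
      rw [e.injective h.choose_spec]
    · simp only [dif_neg i.2]

/-- The tensor product of the Pauli operators `p i` over the qubits outside the support of `e`. -/
def pauliRest {k n : ℕ} (e : Fin k ↪ Fin n) (p : Fin n → Pauli) :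
    Matrix ({i : Fin n // i ∉ Set.range e} → Bool) ({i : Fin n // i ∉ Set.range e} → Bool) ℂ :=
  Matrix.of fun y z => ∏ i : {i : Fin n // i ∉ Set.range e}, (p i).mat (y i) (z i)

theorem prod_eq_prod_range_mul {k n : ℕ} (e : Fin k ↪ Fin n) (f : Fin n → ℂ) :
    ∏ i, f i = (∏ j, f (e j)) * ∏ i : {i : Fin n // i ∉ Set.range e}, f i := by
  classical
  rw [← Fintype.prod_subtype_mul_prod_subtype (fun i => i ∈ Set.range e) f]
  congr 1
  convert (Fintype.prod_equiv (Equiv.ofInjective e e.injective) (fun j => f (e j))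
    (fun i : {i // i ∈ Set.range e} => f i) fun j => rfl).symm

theorem pauliString_eq_submatrix {k n : ℕ} (e : Fin k ↪ Fin n) (p : Fin n → Pauli) :
    pauliString p =
      (pauliString (fun j => p (e j)) ⊗ₖ pauliRest e p).submatrix (bitsSplit e) (bitsSplit e) := by
  ext y z
  simp only [pauliString, pauliRest, Matrix.submatrix_apply, Matrix.kroneckerMap_apply,
    Matrix.of_apply, bitsSplit, Equiv.coe_fn_mk]
  exact prod_eq_prod_range_mul e fun i => (p i).mat (y i) (z i)

theorem applyGate_eq_submatrix {k n : ℕ} (e : Fin k ↪ Fin n) (V : Op k) :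
    applyGate e V = (V ⊗ₖ (1 : Matrix ({i : Fin n // i ∉ Set.range e} → Bool) _ ℂ)).submatrix
      (bitsSplit e) (bitsSplit e) := by
  ext y z
  have h : (∀ i, i ∉ Set.range e → y i = z i) ↔
      (fun i : {i : Fin n // i ∉ Set.range e} => y i) =
        fun i : {i : Fin n // i ∉ Set.range e} => z i := by
    rw [funext_iff, Subtype.forall]
  simp only [applyGate, Matrix.submatrix_apply, Matrix.kroneckerMap_apply,
    Matrix.of_apply, bitsSplit, Equiv.coe_fn_mk, Matrix.one_apply, h, mul_ite, mul_one, mul_zero]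

theorem applyGate_conjTranspose {k n : ℕ} (e : Fin k ↪ Fin n) (V : Op k) :
    (applyGate e V)ᴴ = applyGate e Vᴴ := by
  rw [applyGate_eq_submatrix, applyGate_eq_submatrix, Matrix.conjTranspose_submatrix,
    Matrix.conjTranspose_kronecker, Matrix.conjTranspose_one]

theorem applyGate_one {k n : ℕ} (e : Fin k ↪ Fin n) : applyGate e (1 : Op k) = 1 := by
  rw [applyGate_eq_submatrix, Matrix.one_kronecker_one, Matrix.submatrix_one_equiv]

theorem applyGate_mul {k n : ℕ} (e : Fin k ↪ Fin n) (V W : Op k) :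
    applyGate e (V * W) = applyGate e V * applyGate e W := by
  simp only [applyGate_eq_submatrix]
  rw [Matrix.submatrix_mul_equiv, ← Matrix.mul_kronecker_mul, Matrix.one_mul]

theorem applyGate_conj_pauliString {k n : ℕ} (e : Fin k ↪ Fin n) (V : Op k) (p : Fin n → Pauli) :
    (applyGate e V)ᴴ * pauliString p * applyGate e V =
      ((Vᴴ * pauliString (fun j => p (e j)) * V) ⊗ₖ pauliRest e p).submatrix
        (bitsSplit e) (bitsSplit e) := by
  rw [applyGate_conjTranspose, applyGate_eq_submatrix, applyGate_eq_submatrix,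
    pauliString_eq_submatrix e, Matrix.submatrix_mul_equiv, Matrix.submatrix_mul_equiv,
    ← Matrix.mul_kronecker_mul, ← Matrix.mul_kronecker_mul, Matrix.one_mul, Matrix.mul_one]

theorem submatrix_kronecker_pauliRest {k n : ℕ} (e : Fin k ↪ Fin n) (q : Fin k → Pauli)
    (p : Fin n → Pauli) :
    (pauliString q ⊗ₖ pauliRest e p).submatrix (bitsSplit e) (bitsSplit e) =
      pauliString (Function.extend e q p) := by
  rw [pauliString_eq_submatrix e (Function.extend e q p)]
  have h1 : (fun j => Function.extend e q p (e j)) = q :=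
    funext fun j => e.injective.extend_apply q p j
  have h2 : pauliRest e (Function.extend e q p) = pauliRest e p := by
    ext y z
    simp only [pauliRest, Matrix.of_apply]
    refine Finset.prod_congr rfl fun i _ => ?_
    rw [Function.extend_apply' q p i.1 i.2]
  rw [h1, h2]

/-- Conjugation by a gate rerandomizes the part of a Pauli string on the support of the gate. -/
theorem applyGate_conj_pauliString_eq_sum {k n : ℕ} (e : Fin k ↪ Fin n) (V : QU k)
    (p : Fin n → Pauli) :
    (applyGate e (V : Op k))ᴴ * pauliString p * applyGate e (V : Op k) =
      ∑ q, (pauliCoeff V (fun j => p (e j)) q : ℂ) • pauliString (Function.extend e q p) := by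
  rw [applyGate_conj_pauliString, conj_pauliString_eq_sum]
  simp only [← submatrix_kronecker_pauliRest]
  ext y z
  simp only [Matrix.submatrix_apply, Matrix.kroneckerMap_apply, Matrix.sum_apply,
    Matrix.smul_apply, Finset.sum_mul, smul_eq_mul, mul_assoc]

/-! ### Circuits in the Heisenberg picture -/

theorem circuit_zero {k n : ℕ} (e : Fin 0 → (Fin k ↪ Fin n)) (V : Fin 0 → QU k) :
    circuit e V = 1 := by
  simp [circuit]

theorem circuit_succ {k n m : ℕ} (e : Fin (m + 1) → (Fin k ↪ Fin n)) (V : Fin (m + 1) → QU k) :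
    circuit e V = applyGate (e (Fin.last m)) (V (Fin.last m) : Op k) *
      circuit (fun j => e j.castSucc) (fun j => V j.castSucc) := by
  rw [circuit, List.ofFn_succ', List.concat_eq_append, List.reverse_concat, List.prod_cons]
  rfl

theorem circuit_conjTranspose_mul_self {k n m : ℕ} (e : Fin m → (Fin k ↪ Fin n))
    (V : Fin m → QU k) : (circuit e V)ᴴ * circuit e V = 1 := by
  induction m with
  | zero => simp [circuit_zero]
  | succ m ih =>
    rw [circuit_succ, Matrix.conjTranspose_mul, Matrix.mul_assoc,
      ← Matrix.mul_assoc (applyGate _ _)ᴴ, applyGate_conjTranspose, ← applyGate_mul,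
      QU.conjTranspose_mul_self, applyGate_one, Matrix.one_mul, ih]

theorem continuous_circuit {k n m : ℕ} (e : Fin m → (Fin k ↪ Fin n)) :
    Continuous fun V : Fin m → QU k => circuit e V := by
  induction m with
  | zero => simpa only [circuit_zero] using continuous_const
  | succ m ih =>
    simp only [circuit_succ]
    refine Continuous.matrix_mul ?_
      ((ih fun j => e j.castSucc).comp (continuous_pi fun j => continuous_apply j.castSucc))
    refine continuous_matrix fun y z => ?_
    have h : Continuous fun V : Fin (m + 1) → QU k => (V (Fin.last m) : Op k) :=
      continuous_subtype_val.comp (continuous_apply (Fin.last m))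
    simp only [applyGate, Matrix.of_apply]
    split_ifs
    · exact h.matrix_elem _ _
    · exact continuous_const

/-- The real part of the expectation of `M` in the state `U|0ⁿ⟩`. -/
def expect {n : ℕ} (U M : Op n) : ℝ := (zeroExpect (Uᴴ * M * U)).re

theorem continuous_expect_circuit {k n m : ℕ} (e : Fin m → (Fin k ↪ Fin n)) (M : Op n) :
    Continuous fun V : Fin m → QU k => expect (circuit e V) M := by
  have h := continuous_circuit e
  exact Complex.continuous_re.comp
    (((h.matrix_conjTranspose.matrix_mul continuous_const).matrix_mul h).matrix_elem _ _)

theorem expect_sum {n : ℕ} {ι : Type*} (s : Finset ι) (U : Op n) (c : ι → ℝ) (M : ι → Op n) :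
    expect U (∑ i ∈ s, (c i : ℂ) • M i) = ∑ i ∈ s, c i * expect U (M i) := by
  simp only [expect, zeroExpect, Finset.mul_sum, Finset.sum_mul, Matrix.sum_apply, Complex.re_sum,
    mul_smul_comm, smul_mul_assoc, Matrix.smul_apply, smul_eq_mul, Complex.re_ofReal_mul]

theorem expect_circuit_succ {k n m : ℕ} (e : Fin (m + 1) → (Fin k ↪ Fin n))
    (V : Fin (m + 1) → QU k) (p : Fin n → Pauli) :
    expect (circuit e V) (pauliString p) =
      ∑ q, pauliCoeff (V (Fin.last m)) (fun j => p (e (Fin.last m) j)) q *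
        expect (circuit (fun j => e j.castSucc) (fun j => V j.castSucc))
          (pauliString (Function.extend (e (Fin.last m)) q p)) := by
  rw [← expect_sum, ← applyGate_conj_pauliString_eq_sum, circuit_succ, expect, expect,
    Matrix.conjTranspose_mul]
  simp only [Matrix.mul_assoc]

/-- The expectation `⟨0ⁿ|p|0ⁿ⟩` of a Pauli string: `1` if it consists of `I` and `Z` only. -/
def zeroValue {n : ℕ} (p : Fin n → Pauli) : ℝ :=
  if ∀ i, p i = Pauli.I ∨ p i = Pauli.Z then 1 else 0

theorem zeroExpect_pauliString {n : ℕ} (p : Fin n → Pauli) :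
    zeroExpect (pauliString p) = zeroValue p := by
  unfold zeroExpect zeroValue pauliString
  rw [Matrix.of_apply]
  split_ifs with h
  · rw [Complex.ofReal_one]
    refine Finset.prod_eq_one fun i _ => ?_
    rcases h i with h | h <;> simp [h, Pauli.mat]
  · push Not at h
    obtain ⟨i, hi, hi'⟩ := h
    rw [Complex.ofReal_zero]
    refine Finset.prod_eq_zero (Finset.mem_univ i) ?_
    generalize p i = P at hi hi'
    cases P <;> simp_all [Pauli.mat]

/-! ### The Markov chain on pairs of Pauli strings -/

/-- The average of `⟨p⟩⟨p'⟩` over a circuit of two-design gates, computed in the Heisenberg picture: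
the last gate kills the pair unless `p` and `p'` agree on its support, and otherwise replaces both
restrictions by the same random Pauli string. -/
def pairMoment {k n : ℕ} : (m : ℕ) → (Fin m → (Fin k ↪ Fin n)) → (Fin n → Pauli) →
    (Fin n → Pauli) → ℝ
  | 0, _, p, p' => zeroValue p * zeroValue p'
  | m + 1, e, p, p' =>
    if (fun j => p (e (Fin.last m) j)) = fun j => p' (e (Fin.last m) j) then
      ∑ q, pauliWeight (fun j => p (e (Fin.last m) j)) q *
        pairMoment m (fun j => e j.castSucc) (Function.extend (e (Fin.last m)) q p)
          (Function.extend (e (Fin.last m)) q p')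
    else 0

theorem pairMoment_nonneg {k n m : ℕ} (e : Fin m → (Fin k ↪ Fin n)) (p p' : Fin n → Pauli) :
    0 ≤ pairMoment m e p p' := by
  induction m generalizing p p' with
  | zero =>
    have h : ∀ p : Fin n → Pauli, 0 ≤ zeroValue p := fun p => by
      unfold zeroValue
      split_ifs <;> norm_num
    exact mul_nonneg (h p) (h p')
  | succ m ih =>
    rw [pairMoment]
    split_ifs
    · exact Finset.sum_nonneg fun q _ => mul_nonneg (pauliWeight_nonneg _ _) (ih _ _ _)
    · exact le_rfl

/-- Replacing a nontrivial Pauli operator on one qubit by `Z` can only increase the moment: the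
last gate on the qubit forgets which operator it was, and without such a gate only `I` and `Z`
contribute. -/
theorem pairMoment_le_update {k n m : ℕ} (e : Fin m → (Fin k ↪ Fin n)) (p : Fin n → Pauli)
    (a : Fin n) (ha : p a ≠ Pauli.I) :
    pairMoment m e p p ≤
      pairMoment m e (Function.update p a Pauli.Z) (Function.update p a Pauli.Z) := by
  induction m generalizing p with
  | zero =>
    have h : zeroValue p ≤ zeroValue (Function.update p a Pauli.Z) := by
      unfold zeroValue
      by_cases h : ∀ i, p i = Pauli.I ∨ p i = Pauli.Z
      · have hp : Function.update p a Pauli.Z = p := by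
          rw [Function.update_eq_self_iff]
          exact ((h a).resolve_left ha).symm
        rw [hp]
      · rw [if_neg h]
        split_ifs <;> norm_num
    have h0 : 0 ≤ zeroValue p := by
      unfold zeroValue
      split_ifs <;> norm_num
    exact mul_self_le_mul_self h0 h
  | succ m ih =>
    rw [pairMoment, if_pos rfl, pairMoment, if_pos rfl]
    refine Finset.sum_le_sum fun q _ => ?_
    by_cases hr : a ∈ Set.range (e (Fin.last m))
    · obtain ⟨j, rfl⟩ := hr
      have h1 : Function.extend (e (Fin.last m)) q
          (Function.update p (e (Fin.last m) j) Pauli.Z) = Function.extend (e (Fin.last m)) q p := by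
        funext i
        by_cases hi : ∃ l, e (Fin.last m) l = i
        · obtain ⟨l, rfl⟩ := hi
          rw [(e (Fin.last m)).injective.extend_apply, (e (Fin.last m)).injective.extend_apply]
        · rw [Function.extend_apply' _ _ _ hi, Function.extend_apply' _ _ _ hi,
            Function.update_of_ne fun h => hi ⟨j, h.symm⟩]
      have h2 : (fun l => p (e (Fin.last m) l)) ≠ fun _ => Pauli.I := fun h => ha (congrFun h j)
      have h3 : (fun l => Function.update p (e (Fin.last m) j) Pauli.Z (e (Fin.last m) l)) ≠
          fun _ => Pauli.I := fun h => by
        have := congrFun h j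
        simp at this
      rw [h1, pauliWeight, pauliWeight, if_neg h2, if_neg h3]
    · have h1 : Function.extend (e (Fin.last m)) q (Function.update p a Pauli.Z) =
          Function.update (Function.extend (e (Fin.last m)) q p) a Pauli.Z := by
        funext i
        by_cases hi : ∃ l, e (Fin.last m) l = i
        · obtain ⟨l, rfl⟩ := hi
          rw [(e (Fin.last m)).injective.extend_apply,
            Function.update_of_ne fun h => hr ⟨l, h⟩, (e (Fin.last m)).injective.extend_apply]
        · rw [Function.extend_apply' _ _ _ hi]
          by_cases hia : i = a
          · subst hia
            simp
          · rw [Function.update_of_ne hia, Function.update_of_ne hia,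
              Function.extend_apply' _ _ _ hi]
      have h2 : (fun l => Function.update p a Pauli.Z (e (Fin.last m) l)) =
          fun l => p (e (Fin.last m) l) := by
        funext l
        rw [Function.update_of_ne fun h => hr ⟨l, h⟩]
      rw [h1, h2]
      refine mul_le_mul_of_nonneg_left (ih _ _ ?_) (pauliWeight_nonneg _ _)
      rwa [Function.extend_apply' _ _ _ hr]

theorem integral_last_mul_init {X : Type*} [MeasurableSpace X] (ν : Measure X)
    [IsProbabilityMeasure ν] {m : ℕ} (F : X → ℝ) (H : (Fin m → X) → ℝ) :
    ∫ V : Fin (m + 1) → X, F (V (Fin.last m)) * H (fun j => V j.castSucc)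
        ∂(Measure.pi fun _ => ν) =
      (∫ x, F x ∂ν) * ∫ V, H V ∂(Measure.pi fun _ => ν) := by
  have h := (measurePreserving_piFinSuccAbove (fun _ : Fin (m + 1) => ν) (Fin.last m)).integral_comp'
    fun z => F z.1 * H z.2
  rw [integral_prod_mul] at h
  rw [← h]
  simp only [MeasurableEquiv.piFinSuccAbove_apply, Fin.insertNthEquiv_symm_apply]
  refine integral_congr_ae (Filter.Eventually.of_forall fun V => ?_)
  simp only [Fin.removeNth_last]
  rfl

/-- The second moments of the Pauli expectations are the same for all two-design gates. -/
theorem IsCliffordInvariant.integral_expect_mul_expect {k n m : ℕ} {ν : Measure (QU k)}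
    [IsProbabilityMeasure ν] (hν : IsCliffordInvariant ν) (e : Fin m → (Fin k ↪ Fin n))
    (p p' : Fin n → Pauli) :
    ∫ V, expect (circuit e V) (pauliString p) * expect (circuit e V) (pauliString p')
        ∂(Measure.pi fun _ => ν) = pairMoment m e p p' := by
  induction m generalizing p p' with
  | zero =>
    have h : ∀ (V : Fin 0 → QU k) (p : Fin n → Pauli),
        expect (circuit e V) (pauliString p) = zeroValue p := fun V p => by
      rw [circuit_zero, expect, Matrix.conjTranspose_one, Matrix.one_mul, Matrix.mul_one,
        zeroExpect_pauliString, Complex.ofReal_re]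
    simp only [h, pairMoment]
    simp
  | succ m ih =>
    have hint : ∀ q q' : Fin k → Pauli, Integrable (fun V : Fin (m + 1) → QU k =>
        (pauliCoeff (V (Fin.last m)) (fun j => p (e (Fin.last m) j)) q *
          pauliCoeff (V (Fin.last m)) (fun j => p' (e (Fin.last m) j)) q') *
        (expect (circuit (fun j => e j.castSucc) (fun j => V j.castSucc))
            (pauliString (Function.extend (e (Fin.last m)) q p)) *
          expect (circuit (fun j => e j.castSucc) (fun j => V j.castSucc))
            (pauliString (Function.extend (e (Fin.last m)) q' p')))) (Measure.pi fun _ => ν) := by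
      intro q q'
      have hc : ∀ p q : Fin k → Pauli, Continuous fun V : Fin (m + 1) → QU k =>
          pauliCoeff (V (Fin.last m)) p q := fun p q =>
        (continuous_pauliCoeff p q).comp (continuous_apply _)
      have he : ∀ M : Op n, Continuous fun V : Fin (m + 1) → QU k =>
          expect (circuit (fun j => e j.castSucc) (fun j => V j.castSucc)) M := fun M =>
        (continuous_expect_circuit (fun j => e j.castSucc) M).comp
          (continuous_pi fun j => continuous_apply j.castSucc)
      exact integrable_of_continuous _ (((hc _ _).mul (hc _ _)).mul ((he _).mul (he _)))
    have hexp : ∀ V : Fin (m + 1) → QU k,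
        expect (circuit e V) (pauliString p) * expect (circuit e V) (pauliString p') =
        ∑ q, ∑ q', (pauliCoeff (V (Fin.last m)) (fun j => p (e (Fin.last m) j)) q *
          pauliCoeff (V (Fin.last m)) (fun j => p' (e (Fin.last m) j)) q') *
        (expect (circuit (fun j => e j.castSucc) (fun j => V j.castSucc))
            (pauliString (Function.extend (e (Fin.last m)) q p)) *
          expect (circuit (fun j => e j.castSucc) (fun j => V j.castSucc))
            (pauliString (Function.extend (e (Fin.last m)) q' p'))) := fun V => by
      rw [expect_circuit_succ, expect_circuit_succ, Finset.sum_mul_sum]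
      exact Finset.sum_congr rfl fun q _ => Finset.sum_congr rfl fun q' _ => by ring
    simp only [hexp]
    rw [integral_finsetSum _ fun q _ => integrable_finsetSum _ fun q' _ => hint q q']
    simp_rw [integral_finsetSum _ fun q' _ => hint _ q']
    have hterm : ∀ q q' : Fin k → Pauli, ∫ V : Fin (m + 1) → QU k,
        (pauliCoeff (V (Fin.last m)) (fun j => p (e (Fin.last m) j)) q *
          pauliCoeff (V (Fin.last m)) (fun j => p' (e (Fin.last m) j)) q') *
        (expect (circuit (fun j => e j.castSucc) (fun j => V j.castSucc))
            (pauliString (Function.extend (e (Fin.last m)) q p)) *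
          expect (circuit (fun j => e j.castSucc) (fun j => V j.castSucc))
            (pauliString (Function.extend (e (Fin.last m)) q' p'))) ∂(Measure.pi fun _ => ν) =
        (if (fun j => p (e (Fin.last m) j)) = (fun j => p' (e (Fin.last m) j)) ∧ q = q' then
          pauliWeight (fun j => p (e (Fin.last m) j)) q else 0) *
        pairMoment m (fun j => e j.castSucc) (Function.extend (e (Fin.last m)) q p)
          (Function.extend (e (Fin.last m)) q' p') := fun q q' => by
      rw [← ih, ← hν.integral_eq]
      exact integral_last_mul_init ν
        (fun x => pauliCoeff x (fun j => p (e (Fin.last m) j)) q *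
          pauliCoeff x (fun j => p' (e (Fin.last m) j)) q')
        (fun V => expect (circuit (fun j => e j.castSucc) V)
            (pauliString (Function.extend (e (Fin.last m)) q p)) *
          expect (circuit (fun j => e j.castSucc) V)
            (pauliString (Function.extend (e (Fin.last m)) q' p')))
    simp only [hterm]
    rw [pairMoment]
    split_ifs with h
    · refine Finset.sum_congr rfl fun q _ => ?_
      rw [Finset.sum_eq_single q]
      · rw [if_pos ⟨h, rfl⟩]
      · intro q' _ hq'
        rw [if_neg fun h' => hq' h'.2.symm, zero_mul]
      · simp
    · refine Finset.sum_eq_zero fun q _ => Finset.sum_eq_zero fun q' _ => ?_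
      rw [if_neg fun h' => h h'.1, zero_mul]

/-! ### Clifford circuits and the size of the set of entanglement-killing stabilizers -/

/-- The Pauli string `P_A ⊗ Z(r)_B ⊗ I_C`. -/
def killerLabel {n : ℕ} (a : Fin n) (B : Finset (Fin n)) (P : Pauli) (r : B → Bool) :
    Fin n → Pauli := fun i =>
  if i = a then P
  else if hi : i ∈ B then (if r ⟨i, hi⟩ then Pauli.Z else Pauli.I)
  else Pauli.I

/-- The Pauli string `Z(s)`. -/
def zLabel {n : ℕ} (s : Bits n) : Fin n → Pauli := fun i => if s i then Pauli.Z else Pauli.I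

theorem zLabel_injective {n : ℕ} : Function.Injective (zLabel (n := n)) := by
  intro s t h
  funext i
  have := congrFun h i
  unfold zLabel at this
  cases hs : s i <;> cases ht : t i <;> simp_all

theorem killerLabel_injective {n : ℕ} {a : Fin n} {B : Finset (Fin n)} (haB : a ∉ B)
    {P P' : Pauli} {r r' : B → Bool} (h : killerLabel a B P r = killerLabel a B P' r') :
    P = P' ∧ r = r' := by
  constructor
  · simpa [killerLabel] using congrFun h a
  · funext i
    have hi : (i : Fin n) ≠ a := fun h' => haB (h' ▸ i.2)
    have := congrFun h i
    simp only [killerLabel, if_neg hi, dif_pos i.2] at this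
    cases hs : r i <;> cases ht : r' i <;> simp_all

theorem circuit_conj_pauliString {k n m : ℕ} (e : Fin m → (Fin k ↪ Fin n)) (V : Fin m → QU k)
    (hV : ∀ j, V j ∈ cliffordGroup k) (p : Fin n → Pauli) :
    ∃ (a : ℕ) (q : Fin n → Pauli),
      (circuit e V)ᴴ * pauliString p * circuit e V = Complex.I ^ a • pauliString q := by
  induction m generalizing p with
  | zero => exact ⟨0, p, by simp [circuit_zero]⟩
  | succ m ih =>
    obtain ⟨a, q, h⟩ := clifford_conj (hV (Fin.last m)) fun j => p (e (Fin.last m) j)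
    obtain ⟨b, q', h'⟩ := ih (fun j => e j.castSucc) (fun j => V j.castSucc)
      (fun j => hV j.castSucc) (Function.extend (e (Fin.last m)) q p)
    refine ⟨a + b, q', ?_⟩
    have h1 : (applyGate (e (Fin.last m)) (V (Fin.last m) : Op k))ᴴ * pauliString p *
        applyGate (e (Fin.last m)) (V (Fin.last m) : Op k) =
        Complex.I ^ a • pauliString (Function.extend (e (Fin.last m)) q p) := by
      rw [applyGate_conj_pauliString, h, Matrix.smul_kronecker, Matrix.submatrix_smul,
        Pi.smul_apply, Pi.smul_apply, submatrix_kronecker_pauliRest]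
    calc (circuit e V)ᴴ * pauliString p * circuit e V
        = (circuit (fun j => e j.castSucc) fun j => V j.castSucc)ᴴ *
            ((applyGate (e (Fin.last m)) (V (Fin.last m) : Op k))ᴴ * pauliString p *
              applyGate (e (Fin.last m)) (V (Fin.last m) : Op k)) *
            circuit (fun j => e j.castSucc) fun j => V j.castSucc := by
          rw [circuit_succ, Matrix.conjTranspose_mul]
          simp only [Matrix.mul_assoc]
      _ = _ := by rw [h1, mul_smul_comm, smul_mul_assoc, h', smul_smul, pow_add]

/-- The number of `s` with `D Z(s) D† = ± p` is the squared expectation of `p` in `D|0ⁿ⟩`, which is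
`1` if `p` is a stabilizer of that state up to sign, and `0` otherwise. -/
theorem sum_conj_zString_eq {n : ℕ} {D : Op n} (hD : Dᴴ * D = 1) {p q : Fin n → Pauli} {c : ℕ}
    (hp : Dᴴ * pauliString p * D = Complex.I ^ c • pauliString q) :
    open Classical in
    ∑ s : Bits n, (if ∃ α : Fin 2, D * zString s * Dᴴ = (-1 : ℂ) ^ (α : ℕ) • pauliString p
      then (1 : ℝ) else 0) = expect D (pauliString p) ^ 2 := by
  have hD' : D * Dᴴ = 1 := mul_eq_one_comm.mp hD
  have hsq : (Complex.I ^ c) ^ 2 = 1 := by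
    have h1 : (Dᴴ * pauliString p * D) * (Dᴴ * pauliString p * D) = 1 := by
      calc _ = Dᴴ * pauliString p * (D * Dᴴ) * pauliString p * D := by
            simp only [Matrix.mul_assoc]
        _ = Dᴴ * (pauliString p * pauliString p) * D := by
            rw [hD', Matrix.mul_one]
            simp only [Matrix.mul_assoc]
        _ = 1 := by rw [pauliString_mul_self, Matrix.mul_one, hD]
    rw [hp, smul_mul_assoc, mul_smul_comm, smul_smul, pauliString_mul_self] at h1
    have h2 := congrFun (congrFun h1 fun _ => false) fun _ => false
    simpa [pow_two] using h2
  -- the phase is a sign because `D† p D` squares to the identity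
  have hc : ∃ α : Fin 2, Complex.I ^ c = (-1 : ℂ) ^ (α : ℕ) := by
    rcases sq_eq_one_iff.mp hsq with h | h
    · exact ⟨0, by simp [h]⟩
    · exact ⟨1, by simp [h]⟩
  obtain ⟨α, hα⟩ := hc
  have hαα : ∀ α : Fin 2, (-1 : ℂ) ^ (α : ℕ) * (-1 : ℂ) ^ (α : ℕ) = 1 := fun α => by
    rw [← mul_pow]
    simp
  have key : ∀ s : Bits n,
      (∃ α : Fin 2, D * zString s * Dᴴ = (-1 : ℂ) ^ (α : ℕ) • pauliString p) ↔ q = zLabel s := by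
    intro s
    constructor
    · rintro ⟨β, hβ⟩
      have h1 : zString s = ((-1 : ℂ) ^ (β : ℕ) * (-1 : ℂ) ^ (α : ℕ)) • pauliString q := by
        calc zString s = Dᴴ * D * zString s * (Dᴴ * D) := by simp [hD]
          _ = Dᴴ * (D * zString s * Dᴴ) * D := by simp only [Matrix.mul_assoc]
          _ = _ := by rw [hβ, mul_smul_comm, smul_mul_assoc, hp, hα, smul_smul]
      exact (eq_of_pauliString_eq_smul (p := zLabel s) h1).symm
    · rintro rfl
      refine ⟨α, ?_⟩
      have h1 : zString s = (-1 : ℂ) ^ (α : ℕ) • (Dᴴ * pauliString p * D) := by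
        rw [hp, hα, smul_smul, hαα, one_smul]
        rfl
      rw [h1, mul_smul_comm, smul_mul_assoc]
      congr 1
      calc D * (Dᴴ * pauliString p * D) * Dᴴ = D * Dᴴ * pauliString p * (D * Dᴴ) := by
            simp only [Matrix.mul_assoc]
        _ = pauliString p := by simp [hD']
  have hexp : expect D (pauliString p) ^ 2 = zeroValue q := by
    have h1 : zeroExpect (Dᴴ * pauliString p * D) = (-1 : ℂ) ^ (α : ℕ) * zeroValue q := by
      rw [hp, hα, ← zeroExpect_pauliString]
      rfl
    have h2 : expect D (pauliString p) = (-1 : ℝ) ^ (α : ℕ) * zeroValue q := by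
      rw [expect, h1]
      have : ((-1 : ℂ) ^ (α : ℕ) * zeroValue q) = (((-1 : ℝ) ^ (α : ℕ) * zeroValue q : ℝ) : ℂ) := by
        push_cast
        rfl
      rw [this, Complex.ofReal_re]
    have h3 : ((-1 : ℝ) ^ (α : ℕ)) ^ 2 = 1 := by
      rw [← pow_mul, mul_comm, pow_mul]
      simp
    rw [h2, mul_pow, h3, one_mul, zeroValue]
    split_ifs <;> simp
  simp only [key]
  rw [hexp, zeroValue]
  split_ifs with h
  · have h0 : q = zLabel fun i => decide (q i = Pauli.Z) := by
      funext i
      rcases h i with h | h <;> simp [zLabel, h]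
    rw [Finset.sum_eq_single fun i => decide (q i = Pauli.Z)]
    · rw [if_pos h0]
    · intro s _ hs
      refine if_neg fun h' => hs (zLabel_injective ?_)
      rw [← h', ← h0]
    · simp
  · refine Finset.sum_eq_zero fun s _ => if_neg ?_
    rintro rfl
    refine h fun i => ?_
    unfold zLabel
    cases s i <;> simp

/-- The number of entanglement-killing stabilizers of a Clifford circuit is the sum of the squared
expectations of the operators `P_A ⊗ Z(r)_B ⊗ I_C` with `P ≠ I`. -/
theorem ncard_killSetAll {n : ℕ} {a : Fin n} {B : Finset (Fin n)} (haB : a ∉ B) {D : Op n}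
    (hD : Dᴴ * D = 1)
    (hp : ∀ p : Fin n → Pauli, ∃ (c : ℕ) (q : Fin n → Pauli),
      Dᴴ * pauliString p * D = Complex.I ^ c • pauliString q) :
    ((killSetAll a B D).ncard : ℝ) =
      ∑ t ∈ ({Pauli.X, Pauli.Y, Pauli.Z} : Finset Pauli) ×ˢ (Finset.univ : Finset (B → Bool)),
        expect D (pauliString (killerLabel a B t.1 t.2)) ^ 2 := by
  classical
  have h1 : ∀ t : Pauli × (B → Bool), expect D (pauliString (killerLabel a B t.1 t.2)) ^ 2 =
      ∑ s : Bits n, (if ∃ α : Fin 2, D * zString s * Dᴴ =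
        (-1 : ℂ) ^ (α : ℕ) • pauliString (killerLabel a B t.1 t.2) then (1 : ℝ) else 0) := by
    intro t
    obtain ⟨c, q, h⟩ := hp (killerLabel a B t.1 t.2)
    rw [← sum_conj_zString_eq hD h]
  simp only [h1]
  rw [Finset.sum_comm]
  have h2 : ((killSetAll a B D).ncard : ℝ) =
      ∑ s : Bits n, if s ∈ killSetAll a B D then (1 : ℝ) else 0 := by
    rw [Finset.sum_boole, Set.ncard_eq_toFinset_card', ← Set.filter_mem_univ_eq_toFinset]
  rw [h2]
  refine Finset.sum_congr rfl fun s _ => ?_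
  have hmem : s ∈ killSetAll a B D ↔ ∃ t ∈ ({Pauli.X, Pauli.Y, Pauli.Z} : Finset Pauli) ×ˢ
      (Finset.univ : Finset (B → Bool)), ∃ α : Fin 2, D * zString s * Dᴴ =
        (-1 : ℂ) ^ (α : ℕ) • pauliString (killerLabel a B t.1 t.2) := by
    constructor
    · rintro ((⟨r, α, h⟩ | ⟨r, α, h⟩) | ⟨r, α, h⟩)
      · exact ⟨(Pauli.X, r), by simp, α, h⟩
      · exact ⟨(Pauli.Y, r), by simp, α, h⟩
      · exact ⟨(Pauli.Z, r), by simp, α, h⟩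
    · rintro ⟨⟨P, r⟩, ht, α, h⟩
      simp only [Finset.mem_product, Finset.mem_insert, Finset.mem_singleton, Finset.mem_univ,
        and_true] at ht
      rcases ht with rfl | rfl | rfl
      · exact Or.inl (Or.inl ⟨r, α, h⟩)
      · exact Or.inl (Or.inr ⟨r, α, h⟩)
      · exact Or.inr ⟨r, α, h⟩
  split_ifs with hs
  · obtain ⟨t, ht, α, hα⟩ := hmem.mp hs
    rw [Finset.sum_eq_single_of_mem t ht, if_pos ⟨α, hα⟩]
    intro t' _ hne
    refine if_neg ?_
    rintro ⟨β, hβ⟩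
    rw [hα] at hβ
    have hu : (-1 : ℂ) ^ (β : ℕ) ≠ 0 := pow_ne_zero _ (by norm_num)
    have h3 : pauliString (killerLabel a B t'.1 t'.2) =
        (((-1 : ℂ) ^ (β : ℕ))⁻¹ * (-1 : ℂ) ^ (α : ℕ)) •
          pauliString (killerLabel a B t.1 t.2) := by
      rw [← smul_smul, hβ, smul_smul, inv_mul_cancel₀ hu, one_smul]
    have h4 := killerLabel_injective haB (eq_of_pauliString_eq_smul h3)
    exact hne (Prod.ext h4.1 h4.2)
  · symm
    refine Finset.sum_eq_zero fun t ht => if_neg fun h => hs (hmem.mpr ⟨t, ht, h⟩)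

/-- The average number of entanglement-killing stabilizers as a sum of second moments. -/
theorem expectedKillers_eq {k n m : ℕ} (e : Fin m → (Fin k ↪ Fin n)) {a : Fin n}
    {B : Finset (Fin n)} (haB : a ∉ B) :
    expectedKillers e a B =
      ∑ t ∈ ({Pauli.X, Pauli.Y, Pauli.Z} : Finset Pauli) ×ˢ (Finset.univ : Finset (B → Bool)),
        pairMoment m e (killerLabel a B t.1 t.2) (killerLabel a B t.1 t.2) := by
  have hcard : ∀ g : Fin m → Clifford k,
      ((killSetAll a B (circuit e fun j => ((g j).out : QU k))).ncard : ℝ) =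
      ∑ t ∈ ({Pauli.X, Pauli.Y, Pauli.Z} : Finset Pauli) ×ˢ (Finset.univ : Finset (B → Bool)),
        expect (circuit e fun j => cliffordOut (g j))
          (pauliString (killerLabel a B t.1 t.2)) ^ 2 := fun g =>
    ncard_killSetAll haB (circuit_conjTranspose_mul_self e _)
      (circuit_conj_pauliString e _ fun j => (g j).out.2)
  have hmoment : ∀ p : Fin n → Pauli, pairMoment m e p p =
      (∑ g : Fin m → Clifford k,
        expect (circuit e fun j => cliffordOut (g j)) (pauliString p) ^ 2) /
          (Fintype.card (Fin m → Clifford k) : ℝ) := fun p => by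
    have hc : Continuous fun V : Fin m → QU k => expect (circuit e V) (pauliString p) ^ 2 :=
      (continuous_expect_circuit e (pauliString p)).pow 2
    rw [← (isCliffordInvariant_uniformLaw k).integral_expect_mul_expect e p p, pi_uniformLaw]
    simp only [← pow_two]
    exact integral_uniformLaw _ hc
  simp only [expectedKillers, hcard, hmoment]
  rw [Finset.sum_comm, Finset.sum_div]

theorem killerLabel_apply_self {n : ℕ} (a : Fin n) (B : Finset (Fin n)) (P : Pauli)
    (r : B → Bool) : killerLabel a B P r a = P := by
  simp [killerLabel]

theorem update_killerLabel {n : ℕ} (a : Fin n) (B : Finset (Fin n)) (P : Pauli) (r : B → Bool) :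
    Function.update (killerLabel a B P r) a Pauli.Z = killerLabel a B Pauli.Z r := by
  funext i
  by_cases hi : i = a
  · subst hi
    simp [killerLabel]
  · rw [Function.update_of_ne hi]
    simp [killerLabel, hi]

theorem expectedKillers_le {k n m : ℕ} (e : Fin m → (Fin k ↪ Fin n)) {a : Fin n}
    {B : Finset (Fin n)} (haB : a ∉ B) :
    expectedKillers e a B ≤ 3 * ∑ r : B → Bool,
      pairMoment m e (killerLabel a B Pauli.Z r) (killerLabel a B Pauli.Z r) := by
  rw [expectedKillers_eq e haB, Finset.sum_product]
  have h : ∀ P ∈ ({Pauli.X, Pauli.Y, Pauli.Z} : Finset Pauli),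
      ∑ r : B → Bool, pairMoment m e (killerLabel a B P r) (killerLabel a B P r) ≤
        ∑ r : B → Bool,
          pairMoment m e (killerLabel a B Pauli.Z r) (killerLabel a B Pauli.Z r) := by
    intro P hP
    refine Finset.sum_le_sum fun r _ => ?_
    have h1 := pairMoment_le_update e (killerLabel a B P r) a (by
      rw [killerLabel_apply_self]
      rintro rfl
      simp at hP)
    rwa [update_killerLabel] at h1
  have h2 := Finset.sum_le_card_nsmul _ _ _ h
  have h3 : ({Pauli.X, Pauli.Y, Pauli.Z} : Finset Pauli).card = 3 := by decide
  rw [h3, nsmul_eq_mul] at h2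
  exact_mod_cast h2

/-! ### Subsystem anticoncentration -/

/-- The Pauli string `Z(r)` on the qubits in `Q`. -/
def zOn {n : ℕ} (Q : Finset (Fin n)) (r : Q → Bool) : Fin n → Pauli := fun i =>
  if hi : i ∈ Q then (if r ⟨i, hi⟩ then Pauli.Z else Pauli.I) else Pauli.I

theorem sum_pauliString_zOn {n : ℕ} (Q : Finset (Fin n)) :
    ∑ r : Q → Bool, pauliString (zOn Q r) = ((2 ^ Q.card : ℝ) : ℂ) • proj Q fun _ => false := by
  ext y z
  simp only [Matrix.sum_apply, Matrix.smul_apply, proj, smul_eq_mul]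
  by_cases hyz : y = z
  · subst hyz
    have h1 : ∀ r : Q → Bool, pauliString (zOn Q r) y y =
        ∏ i : Q, if r i then (if y i then (-1 : ℂ) else 1) else 1 := by
      intro r
      simp only [pauliString, Matrix.of_apply]
      have h2 : ∀ i : Fin n, (zOn Q r i).mat (y i) (y i) =
          if hi : i ∈ Q then (if r ⟨i, hi⟩ then (if y i then (-1 : ℂ) else 1) else 1) else 1 := by
        intro i
        unfold zOn
        split_ifs <;> simp_all [Pauli.mat]
      simp only [h2]
      rw [Finset.prod_dite]
      simp only [Finset.prod_const_one, mul_one]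
      refine Finset.prod_bij' (fun i _ => ⟨i.1, (Finset.mem_filter.mp i.2).2⟩)
        (fun i _ => ⟨i.1, Finset.mem_filter.mpr ⟨Finset.mem_univ _, i.2⟩⟩) ?_ ?_ ?_ ?_ ?_ <;> simp
    simp only [h1]
    rw [← Fintype.piFinset_univ, ← Finset.prod_univ_sum (fun _ => Finset.univ)
      (fun (i : Q) (b : Bool) => if b then (if y i then (-1 : ℂ) else 1) else 1)]
    rw [Matrix.diagonal_apply_eq]
    split_ifs with h
    · simp [h]
    · push Not at h
      obtain ⟨i, hi⟩ := h
      rw [mul_zero]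
      refine Finset.prod_eq_zero (Finset.mem_univ i) ?_
      simp_all
  · rw [Matrix.diagonal_apply_ne _ hyz, mul_zero]
    refine Finset.sum_eq_zero fun r _ => ?_
    obtain ⟨j, hj⟩ := Function.ne_iff.mp hyz
    refine Finset.prod_eq_zero (Finset.mem_univ j) ?_
    unfold zOn
    split_ifs <;> simp [Pauli.mat, hj]

theorem expect_smul {n : ℕ} (U M : Op n) (c : ℝ) : expect U ((c : ℂ) • M) = c * expect U M := by
  simpa using expect_sum {()} U (fun _ => c) fun _ => M

theorem expect_one {n : ℕ} {U : Op n} (hU : Uᴴ * U = 1) : expect U 1 = 1 := by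
  simp [expect, hU, zeroExpect]

theorem two_pow_mul_zeroProb {n : ℕ} (Q : Finset (Fin n)) (U : Op n) :
    2 ^ Q.card * zeroProb Q U = ∑ r : Q → Bool, expect U (pauliString (zOn Q r)) := by
  have h := expect_sum Finset.univ U (fun _ => 1) fun r : Q → Bool => pauliString (zOn Q r)
  simp only [Complex.ofReal_one, one_smul, one_mul] at h
  rw [← h, sum_pauliString_zOn, expect_smul]
  rfl

theorem chi_eq {k n m : ℕ} (e : Fin m → (Fin k ↪ Fin n)) (a : Fin n) (B : Finset (Fin n)) :
    chi e a B = (∑ r : ↥(insert a B) → Bool, ∑ r' : ↥(insert a B) → Bool,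
      pairMoment m e (zOn (insert a B) r) (zOn (insert a B) r')) - 1 := by
  have hint : ∀ p q : Fin n → Pauli, Integrable (fun V : Fin m → QU k =>
      expect (circuit e V) (pauliString p) * expect (circuit e V) (pauliString q))
        (haarGates k m) := fun p q => by
    unfold haarGates
    exact integrable_of_continuous _
      ((continuous_expect_circuit e (pauliString p)).mul
        (continuous_expect_circuit e (pauliString q)))
  have h4 : (4 : ℝ) ^ (insert a B).card = 2 ^ (insert a B).card * 2 ^ (insert a B).card := by
    rw [← mul_pow]
    norm_num
  have hsq : ∀ U : Op n, 4 ^ (insert a B).card * zeroProb (insert a B) U ^ 2 =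
      ∑ r : ↥(insert a B) → Bool, ∑ r' : ↥(insert a B) → Bool,
        expect U (pauliString (zOn (insert a B) r)) *
          expect U (pauliString (zOn (insert a B) r')) := fun U => by
    rw [← Finset.sum_mul_sum, ← two_pow_mul_zeroProb, h4]
    ring
  have hmoment : ∀ p q : Fin n → Pauli, pairMoment m e p q = ∫ V : Fin m → QU k,
      expect (circuit e V) (pauliString p) * expect (circuit e V) (pauliString q)
        ∂(haarGates k m) := fun p q =>
    ((isCliffordInvariant_haarU k).integral_expect_mul_expect e p q).symm
  rw [chi, ← integral_const_mul]
  simp only [hsq, hmoment]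
  rw [integral_finsetSum _ fun r _ => integrable_finsetSum _ fun r' _ => hint _ _]
  simp_rw [integral_finsetSum _ fun r' _ => hint _ _]

theorem pairMoment_one {k n m : ℕ} (e : Fin m → (Fin k ↪ Fin n)) :
    pairMoment m e (fun _ => Pauli.I) (fun _ => Pauli.I) = 1 := by
  rw [← (isCliffordInvariant_haarU k).integral_expect_mul_expect e, pauliString_one]
  simp [expect_one (circuit_conjTranspose_mul_self e _)]

/-- All second moments are nonnegative, so `χ + 1` is at least the sum of the contributions of the
identity and of the strings `Z_A ⊗ Z(r)_B`. -/
theorem sum_pairMoment_le_chi {k n m : ℕ} (e : Fin m → (Fin k ↪ Fin n)) {a : Fin n}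
    {B : Finset (Fin n)} (haB : a ∉ B) :
    ∑ r : B → Bool, pairMoment m e (killerLabel a B Pauli.Z r) (killerLabel a B Pauli.Z r) ≤
      chi e a B := by
  -- `none` labels the identity, and `some r` the string `Z_A ⊗ Z(r)_B`
  let φ : Option (B → Bool) → (↥(insert a B) → Bool)
    | none => fun _ => false
    | some r => fun i => if h : (i : Fin n) ∈ B then r ⟨i, h⟩ else true
  have hnone : zOn (insert a B) (φ none) = fun _ => Pauli.I := by
    funext i
    simp [zOn, φ]
  have hsome : ∀ r, zOn (insert a B) (φ (some r)) = killerLabel a B Pauli.Z r := by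
    intro r
    funext i
    by_cases hi : i = a
    · subst hi
      simp [zOn, φ, killerLabel, haB]
    · by_cases hB : i ∈ B <;> simp [zOn, φ, killerLabel, hi, hB]
  have hφ : Function.Injective φ := by
    intro o o' h
    have h' : zOn (insert a B) (φ o) = zOn (insert a B) (φ o') := by rw [h]
    cases o with
    | none =>
      cases o' with
      | none => rfl
      | some r =>
        rw [hnone, hsome] at h'
        have := congrFun h' a
        simp [killerLabel] at this
    | some r =>
      cases o' with
      | none =>
        rw [hnone, hsome] at h'
        have := congrFun h' a
        simp [killerLabel] at this
      | some r' =>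
        rw [hsome, hsome] at h'
        rw [(killerLabel_injective haB h').2]
  have h1 : ∑ o, pairMoment m e (zOn (insert a B) (φ o)) (zOn (insert a B) (φ o)) ≤
      ∑ r : ↥(insert a B) → Bool,
        pairMoment m e (zOn (insert a B) r) (zOn (insert a B) r) := by
    refine (Finset.sum_map Finset.univ ⟨φ, hφ⟩
      fun r => pairMoment m e (zOn (insert a B) r) (zOn (insert a B) r)).symm.trans_le ?_
    exact Finset.sum_le_univ_sum_of_nonneg fun r => pairMoment_nonneg e _ _
  have h2 : ∑ r : ↥(insert a B) → Bool,
      pairMoment m e (zOn (insert a B) r) (zOn (insert a B) r) ≤ ∑ r : ↥(insert a B) → Bool,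
        ∑ r' : ↥(insert a B) → Bool,
          pairMoment m e (zOn (insert a B) r) (zOn (insert a B) r') :=
    Finset.sum_le_sum fun r _ => Finset.single_le_sum
      (f := fun r' => pairMoment m e (zOn (insert a B) r) (zOn (insert a B) r'))
      (fun r' _ => pairMoment_nonneg e _ _) (Finset.mem_univ r)
  rw [Fintype.sum_option, hnone, pairMoment_one] at h1
  simp only [hsome] at h1
  rw [chi_eq]
  linarith

/-! ### The purity of the post-measurement state -/

/-- The unnormalized state `q(x) ρ(x)` of the qubit `a` after outcome `x` on `B`. -/
def rawState {n : ℕ} (a : Fin n) (B : Finset (Fin n)) (U : Op n) (x : B → Bool) :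
    Matrix Bool Bool ℂ :=
  reduceTo a (proj B x * (U * zeroState n * Uᴴ) * proj B x)

/-- The amplitude of the basis state `y` in `U|0ⁿ⟩`. -/
def amp {n : ℕ} (U : Op n) (y : Bits n) : ℂ := U y fun _ => false

/-- The indicator that the basis state `y` has the values `x` on `B`. -/
def agrees {n : ℕ} (B : Finset (Fin n)) (x : B → Bool) (y : Bits n) : ℂ :=
  if ∀ i : B, y i = x i then 1 else 0

theorem agrees_update {n : ℕ} {a : Fin n} {B : Finset (Fin n)} (haB : a ∉ B) (x : B → Bool)
    (y : Bits n) (b : Bool) : agrees B x (Function.update y a b) = agrees B x y := by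
  have h : ∀ i : B, Function.update y a b i = y i := fun i =>
    Function.update_of_ne (fun h : (i : Fin n) = a => haB (h ▸ i.2)) _ _
  simp only [agrees, h]

theorem agrees_mul_self {n : ℕ} (B : Finset (Fin n)) (x : B → Bool) (y : Bits n) :
    agrees B x y * agrees B x y = agrees B x y := by
  unfold agrees
  split_ifs <;> simp

theorem conj_agrees {n : ℕ} (B : Finset (Fin n)) (x : B → Bool) (y : Bits n) :
    conj (agrees B x y) = agrees B x y := by
  unfold agrees
  split_ifs <;> simp

theorem sum_mul_agrees {n : ℕ} (B : Finset (Fin n)) (f : (B → Bool) → ℂ) (y : Bits n) :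
    ∑ x, f x * agrees B x y = f fun i => y i := by
  rw [Finset.sum_eq_single fun i : B => y i]
  · simp [agrees]
  · intro x _ hx
    rw [agrees, if_neg fun h => hx (funext fun i => (h i).symm), mul_zero]
  · simp

theorem mul_zeroState_mul_apply {n : ℕ} (U : Op n) (y z : Bits n) :
    (U * zeroState n * Uᴴ) y z = amp U y * conj (amp U z) := by
  rw [Matrix.mul_apply, Finset.sum_eq_single fun _ => false]
  · simp [zeroState, amp, Matrix.conjTranspose_apply]
  · intro w _ hw
    rw [zeroState, Matrix.mul_single_apply_of_ne (hbj := hw), zero_mul]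
  · simp

theorem rawState_apply {n : ℕ} {a : Fin n} {B : Finset (Fin n)} (haB : a ∉ B) (U : Op n)
    (x : B → Bool) (i j : Bool) :
    rawState a B U x i j = ∑ y : Bits n, if y a = i then
      agrees B x y * (amp U y * conj (amp U (Function.update y a j))) else 0 := by
  simp only [rawState, reduceTo, Matrix.of_apply]
  refine Finset.sum_congr rfl fun y _ => ?_
  have h : (proj B x * (U * zeroState n * Uᴴ) * proj B x) y (Function.update y a j) =
      agrees B x y * (amp U y * conj (amp U (Function.update y a j))) *
        agrees B x (Function.update y a j) := by
    rw [proj, Matrix.mul_diagonal, Matrix.diagonal_mul, mul_zeroState_mul_apply]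
    rfl
  rw [h, agrees_update haB]
  congr 1
  linear_combination (amp U y * conj (amp U (Function.update y a j))) * agrees_mul_self B x y

/-- Sums over the basis states with value `i` on the qubit `a`, parametrized by the basis states
with value `0` there. -/
theorem sum_ite_apply_eq {n : ℕ} (a : Fin n) (i : Bool) (g : Bits n → ℂ) :
    (∑ y : Bits n, if y a = i then g y else 0) =
      ∑ y : Bits n with y a = false, g (Function.update y a i) := by
  rw [← Finset.sum_filter]
  refine Finset.sum_nbij' (fun y => Function.update y a false) (fun y => Function.update y a i)
    ?_ ?_ ?_ ?_ ?_
  · intro y _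
    simp
  · intro y _
    simp
  · intro y hy
    rw [Finset.mem_filter] at hy
    simp [← hy.2]
  · intro y hy
    rw [Finset.mem_filter] at hy
    simp [← hy.2]
  · intro y hy
    rw [Finset.mem_filter] at hy
    simp [← hy.2]

/-- The post-measurement state as a mixture of the pure states that belong to the basis states of
the other qubits. -/
theorem rawState_apply_eq_sum {n : ℕ} {a : Fin n} {B : Finset (Fin n)} (haB : a ∉ B) (U : Op n)
    (x : B → Bool) (i j : Bool) :
    rawState a B U x i j = ∑ y : Bits n with y a = false,
      (agrees B x y * amp U (Function.update y a i)) *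
        conj (agrees B x y * amp U (Function.update y a j)) := by
  rw [rawState_apply haB, sum_ite_apply_eq]
  refine Finset.sum_congr rfl fun y _ => ?_
  rw [agrees_update haB, Function.update_idem, map_mul, conj_agrees]
  linear_combination -(amp U (Function.update y a i) * conj (amp U (Function.update y a j))) *
    agrees_mul_self B x y

theorem conj_rawState {n : ℕ} {a : Fin n} {B : Finset (Fin n)} (haB : a ∉ B) (U : Op n)
    (x : B → Bool) (i j : Bool) : conj (rawState a B U x i j) = rawState a B U x j i := by
  rw [rawState_apply_eq_sum haB, rawState_apply_eq_sum haB, map_sum]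
  refine Finset.sum_congr rfl fun y _ => ?_
  rw [map_mul, Complex.conj_conj, mul_comm]

theorem rawState_diag {n : ℕ} {a : Fin n} {B : Finset (Fin n)} (haB : a ∉ B) (U : Op n)
    (x : B → Bool) (i : Bool) :
    rawState a B U x i i = ((∑ y : Bits n with y a = false,
      ‖agrees B x y * amp U (Function.update y a i)‖ ^ 2 : ℝ) : ℂ) := by
  rw [rawState_apply_eq_sum haB]
  push_cast
  exact Finset.sum_congr rfl fun y _ => Complex.mul_conj' _

/-- Positivity of the post-measurement state: its determinant is nonnegative. -/
theorem norm_rawState_sq_le {n : ℕ} {a : Fin n} {B : Finset (Fin n)} (haB : a ∉ B) (U : Op n)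
    (x : B → Bool) (i j : Bool) :
    ‖rawState a B U x i j‖ ^ 2 ≤ (rawState a B U x i i).re * (rawState a B U x j j).re := by
  rw [rawState_diag haB, rawState_diag haB, Complex.ofReal_re, Complex.ofReal_re]
  refine le_trans ?_ (Finset.sum_mul_sq_le_sq_mul_sq _ _ _)
  refine pow_le_pow_left₀ (norm_nonneg _) ?_ 2
  rw [rawState_apply_eq_sum haB]
  refine (norm_sum_le _ _).trans (le_of_eq (Finset.sum_congr rfl fun y _ => ?_))
  rw [norm_mul, RCLike.norm_conj]

/-- The unnormalized Pauli expectation `⟨P ⊗ Π(x)⟩`. -/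
def bloch {n : ℕ} (a : Fin n) (B : Finset (Fin n)) (U : Op n) (P : Pauli) (x : B → Bool) : ℝ :=
  (∑ i, ∑ j, P.mat i j * rawState a B U x j i).re

theorem outcomeProb_eq {n : ℕ} {a : Fin n} {B : Finset (Fin n)} (haB : a ∉ B) (U : Op n)
    (x : B → Bool) :
    outcomeProb B U x = (rawState a B U x false false).re + (rawState a B U x true true).re := by
  rw [← Complex.add_re, rawState_apply haB, rawState_apply haB, ← Finset.sum_add_distrib,
    outcomeProb, zeroExpect, proj, Matrix.mul_apply]
  congr 1
  refine Finset.sum_congr rfl fun y _ => ?_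
  have h : (if y a = false then
        agrees B x y * (amp U y * conj (amp U (Function.update y a false))) else 0) +
      (if y a = true then
        agrees B x y * (amp U y * conj (amp U (Function.update y a true))) else 0) =
      agrees B x y * (amp U y * conj (amp U y)) := by
    have hu := Function.update_eq_self a y
    cases hy : y a <;> rw [hy] at hu <;> simp [hu]
  rw [h, Matrix.mul_diagonal, Matrix.conjTranspose_apply]
  change star (amp U y) * agrees B x y * amp U y = _
  rw [Complex.star_def]
  ring

/-- The squared length of the unnormalized Bloch vector. -/
def blochSq {n : ℕ} (a : Fin n) (B : Finset (Fin n)) (U : Op n) (x : B → Bool) : ℝ :=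
  ∑ P ∈ ({Pauli.X, Pauli.Y, Pauli.Z} : Finset Pauli), bloch a B U P x ^ 2

theorem blochSq_eq {n : ℕ} {a : Fin n} {B : Finset (Fin n)} (haB : a ∉ B) (U : Op n)
    (x : B → Bool) :
    blochSq a B U x =
      ((rawState a B U x false false).re - (rawState a B U x true true).re) ^ 2 +
        4 * ‖rawState a B U x false true‖ ^ 2 := by
  have h1 : rawState a B U x true false = conj (rawState a B U x false true) :=
    (conj_rawState haB U x false true).symm
  have hX : bloch a B U Pauli.X x = 2 * (rawState a B U x false true).re := by
    simp [bloch, Pauli.mat, h1]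
    ring
  have hY : bloch a B U Pauli.Y x ^ 2 = (2 * (rawState a B U x false true).im) ^ 2 := by
    simp [bloch, Pauli.mat, h1]
    ring
  have hZ : bloch a B U Pauli.Z x =
      (rawState a B U x false false).re - (rawState a B U x true true).re := by
    simp [bloch, Pauli.mat]
    ring
  have hs : blochSq a B U x = bloch a B U Pauli.X x ^ 2 + (bloch a B U Pauli.Y x ^ 2 +
      bloch a B U Pauli.Z x ^ 2) := by
    rw [blochSq, Finset.sum_insert (by decide), Finset.sum_insert (by decide),
      Finset.sum_singleton]
  rw [hs, hX, hY, hZ, Complex.sq_norm, Complex.normSq_apply]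
  ring

theorem trace_rawState_sq {n : ℕ} {a : Fin n} {B : Finset (Fin n)} (haB : a ∉ B) (U : Op n)
    (x : B → Bool) :
    (Matrix.trace (rawState a B U x ^ 2)).re =
      (outcomeProb B U x ^ 2 + blochSq a B U x) / 2 := by
  have h1 : rawState a B U x true false = conj (rawState a B U x false true) :=
    (conj_rawState haB U x false true).symm
  have him : ∀ i, (rawState a B U x i i).im = 0 := fun i =>
    Complex.conj_eq_iff_im.mp (conj_rawState haB U x i i)
  rw [blochSq_eq haB, outcomeProb_eq haB, Complex.sq_norm, Complex.normSq_apply, pow_two]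
  simp [Matrix.trace, Matrix.mul_apply, h1, him]
  ring

theorem blochSq_le {n : ℕ} {a : Fin n} {B : Finset (Fin n)} (haB : a ∉ B) (U : Op n)
    (x : B → Bool) : blochSq a B U x ≤ outcomeProb B U x ^ 2 := by
  rw [blochSq_eq haB, outcomeProb_eq haB]
  have := norm_rawState_sq_le haB U x false true
  linarith

theorem outcomeProb_nonneg {n : ℕ} {a : Fin n} {B : Finset (Fin n)} (haB : a ∉ B) (U : Op n)
    (x : B → Bool) : 0 ≤ outcomeProb B U x := by
  rw [outcomeProb_eq haB, rawState_diag haB, rawState_diag haB, Complex.ofReal_re,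
    Complex.ofReal_re]
  positivity

theorem avgPurity_term {n : ℕ} {a : Fin n} {B : Finset (Fin n)} (haB : a ∉ B) (U : Op n)
    (x : B → Bool) :
    outcomeProb B U x * (Matrix.trace (postState a B U x ^ 2)).re =
      outcomeProb B U x * (outcomeProb B U x)⁻¹ ^ 2 *
        ((outcomeProb B U x ^ 2 + blochSq a B U x) / 2) := by
  rw [← trace_rawState_sq haB]
  have h : postState a B U x =
      (((outcomeProb B U x)⁻¹ : ℝ) : ℂ) • rawState a B U x := by
    rw [Complex.ofReal_inv]
    rfl
  rw [h, smul_pow, Matrix.trace_smul, smul_eq_mul, ← Complex.ofReal_pow, Complex.re_ofReal_mul,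
    mul_assoc]

theorem blochSq_nonneg {n : ℕ} (a : Fin n) (B : Finset (Fin n)) (U : Op n) (x : B → Bool) :
    0 ≤ blochSq a B U x :=
  Finset.sum_nonneg fun _ _ => sq_nonneg _

theorem avgPurity_term_le {n : ℕ} {a : Fin n} {B : Finset (Fin n)} (haB : a ∉ B) (U : Op n)
    (x : B → Bool) :
    outcomeProb B U x * (Matrix.trace (postState a B U x ^ 2)).re ≤
      1 / 2 * outcomeProb B U x + 1 / 2 * Real.sqrt (blochSq a B U x) := by
  rw [avgPurity_term haB]
  have h0 := outcomeProb_nonneg haB U x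
  have h1 := blochSq_nonneg a B U x
  have h2 := blochSq_le haB U x
  generalize outcomeProb B U x = q at h0 h2 ⊢
  generalize blochSq a B U x = t at h1 h2 ⊢
  have hs := Real.sqrt_nonneg t
  -- outcomes of probability `0` contribute nothing, since `0⁻¹ = 0`
  rcases h0.eq_or_lt with rfl | hq
  · simp
  · have hsq : Real.sqrt t ≤ q := Real.sqrt_le_iff.mpr ⟨h0, h2⟩
    have ht : t ≤ q * Real.sqrt t := by
      calc t = Real.sqrt t * Real.sqrt t := (Real.mul_self_sqrt h1).symm
        _ ≤ q * Real.sqrt t := mul_le_mul_of_nonneg_right hsq hs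
    have e : q * q⁻¹ ^ 2 * ((q ^ 2 + t) / 2) = 1 / 2 * q + 1 / 2 * (t / q) := by
      field_simp
    have h3 : t / q ≤ Real.sqrt t := by
      rw [div_le_iff₀ hq]
      linarith
    rw [e]
    linarith

theorem sum_outcomeProb {n : ℕ} (B : Finset (Fin n)) {U : Op n} (hU : Uᴴ * U = 1) :
    ∑ x : B → Bool, outcomeProb B U x = 1 := by
  have h1 : ∑ x : B → Bool, proj B x = (1 : Op n) := by
    ext y z
    rw [Matrix.sum_apply]
    by_cases hyz : y = z
    · subst hyz
      have := sum_mul_agrees B (fun _ => 1) y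
      simp only [one_mul, agrees] at this
      simp only [proj, Matrix.diagonal_apply_eq, Matrix.one_apply_eq, this]
    · simp [proj, hyz]
  have h2 := expect_sum Finset.univ U (fun _ => 1) fun x : B → Bool => proj B x
  simp only [Complex.ofReal_one, one_smul, one_mul, h1, expect_one hU] at h2
  exact h2.symm

/-- The character `(-1)^(r · x)` of bit strings. -/
def bitChar {ι : Type*} [Fintype ι] (r x : ι → Bool) : ℝ := ∏ i, if r i && x i then -1 else 1

theorem sum_bitChar_mul_bitChar {ι : Type*} [Fintype ι] [DecidableEq ι] (x y : ι → Bool) :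
    ∑ r, bitChar r x * bitChar r y = if x = y then 2 ^ Fintype.card ι else 0 := by
  simp only [bitChar, ← Finset.prod_mul_distrib]
  rw [← Fintype.piFinset_univ, ← Finset.prod_univ_sum (fun _ => Finset.univ)
    (fun i b => (if b && x i then (-1 : ℝ) else 1) * (if b && y i then (-1 : ℝ) else 1))]
  have h : ∀ b c : Bool, ∑ r : Bool, (if r && b then (-1 : ℝ) else 1) *
      (if r && c then (-1 : ℝ) else 1) = if b = c then 2 else 0 := by
    intro b c
    cases b <;> cases c <;> norm_num
  simp only [h]
  split_ifs with hxy
  · simp [hxy]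
  · obtain ⟨i, hi⟩ := Function.ne_iff.mp hxy
    exact Finset.prod_eq_zero (Finset.mem_univ i) (if_neg hi)

/-- Parseval's identity on bit strings. -/
theorem sum_sq_sum_bitChar {ι : Type*} [Fintype ι] [DecidableEq ι] (t : (ι → Bool) → ℝ) :
    ∑ r, (∑ x, bitChar r x * t x) ^ 2 = 2 ^ Fintype.card ι * ∑ x, t x ^ 2 := by
  have h : ∀ r, (∑ x, bitChar r x * t x) ^ 2 =
      ∑ x, ∑ y, (bitChar r x * bitChar r y) * (t x * t y) := fun r => by
    rw [pow_two, Finset.sum_mul_sum]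
    exact Finset.sum_congr rfl fun x _ => Finset.sum_congr rfl fun y _ => by ring
  simp only [h]
  rw [Finset.sum_comm, Finset.mul_sum]
  refine Finset.sum_congr rfl fun x _ => ?_
  rw [Finset.sum_comm]
  simp only [← Finset.sum_mul, sum_bitChar_mul_bitChar]
  simp [pow_two]

theorem killerLabel_entry {n : ℕ} {a : Fin n} {B : Finset (Fin n)} (haB : a ∉ B) (P : Pauli)
    (r : B → Bool) (y z : Bits n) :
    pauliString (killerLabel a B P r) y z =
      ∑ i : Bool, if y = Function.update z a i then
        P.mat i (z a) * ((bitChar r fun j => z j : ℝ) : ℂ) else 0 := by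
  by_cases hy : y = Function.update z a (y a)
  · have hsum : ∀ c : Bool → ℂ, (∑ i : Bool, if y = Function.update z a i then c i else 0) =
        c (y a) := by
      intro c
      rw [Finset.sum_eq_single (y a), if_pos hy]
      · intro i _ hi
        refine if_neg fun h => hi ?_
        rw [h, Function.update_self]
      · simp
    rw [hsum]
    have hyz : ∀ i, i ≠ a → y i = z i := fun i hi => by
      rw [hy, Function.update_of_ne hi]
    simp only [pauliString, Matrix.of_apply]
    rw [← Finset.mul_prod_erase _ _ (Finset.mem_univ a), killerLabel_apply_self]
    congr 1
    have h2 : ∀ i ∈ Finset.univ.erase a, (killerLabel a B P r i).mat (y i) (z i) =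
        if hi : i ∈ B then (if r ⟨i, hi⟩ && z i then (-1 : ℂ) else 1) else 1 := by
      intro i hi
      have hia := Finset.ne_of_mem_erase hi
      rw [hyz i hia]
      have hmat : ∀ b c : Bool, (if c then Pauli.Z else Pauli.I).mat b b =
          if c && b then (-1 : ℂ) else 1 := by
        intro b c
        cases b <;> cases c <;> simp [Pauli.mat]
      simp only [killerLabel, if_neg hia]
      by_cases hB : i ∈ B
      · simp only [dif_pos hB, hmat]
      · simp [hB, Pauli.mat]
    rw [Finset.prod_congr rfl h2, bitChar, Complex.ofReal_prod]
    have h3 : Finset.univ.erase a = (Finset.univ.erase a \ B) ∪ B := by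
      rw [Finset.sdiff_union_of_subset]
      intro i hi
      exact Finset.mem_erase.mpr ⟨fun h => haB (h ▸ hi), Finset.mem_univ _⟩
    rw [h3, Finset.prod_union Finset.sdiff_disjoint, Finset.prod_eq_one, one_mul,
      ← Finset.prod_coe_sort]
    · refine Finset.prod_congr rfl fun i _ => ?_
      rw [dif_pos i.2]
      split_ifs <;> simp
    · intro i hi
      rw [dif_neg (Finset.mem_sdiff.mp hi).2]
  · have h1 : ∀ i, y ≠ Function.update z a i := by
      rintro i rfl
      exact hy (by rw [Function.update_self])
    rw [Finset.sum_eq_zero fun i _ => if_neg (h1 i)]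
    have h2 : ∃ i, i ≠ a ∧ y i ≠ z i := by
      by_contra h
      push Not at h
      refine hy (funext fun i => ?_)
      by_cases hi : i = a
      · subst hi
        rw [Function.update_self]
      · rw [Function.update_of_ne hi, h i hi]
    obtain ⟨i, hia, hi⟩ := h2
    refine Finset.prod_eq_zero (Finset.mem_univ i) ?_
    simp only [killerLabel, if_neg hia]
    split_ifs <;> simp [Pauli.mat, hi]

/-- The expectations `⟨P_A ⊗ Z(r)_B⟩` are the Fourier coefficients of the Bloch vectors. -/
theorem expect_killerLabel {n : ℕ} {a : Fin n} {B : Finset (Fin n)} (haB : a ∉ B) (U : Op n)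
    (P : Pauli) (r : B → Bool) :
    expect U (pauliString (killerLabel a B P r)) = ∑ x, bitChar r x * bloch a B U P x := by
  have hR : ∑ x, bitChar r x * bloch a B U P x =
      (∑ x, (bitChar r x : ℂ) * ∑ i, ∑ j, P.mat i j * rawState a B U x j i).re := by
    simp only [Complex.re_sum, Complex.re_ofReal_mul, bloch]
  rw [hR, expect, zeroExpect]
  congr 1
  have hL : (Uᴴ * pauliString (killerLabel a B P r) * U) (fun _ => false) (fun _ => false) =
      ∑ z : Bits n, ∑ i : Bool, conj (amp U (Function.update z a i)) *
        (P.mat i (z a) * ((bitChar r fun j => z j : ℝ) : ℂ)) * amp U z := by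
    rw [Matrix.mul_apply]
    refine Finset.sum_congr rfl fun z _ => ?_
    simp only [Matrix.mul_apply, killerLabel_entry haB, Finset.mul_sum, mul_ite, mul_zero]
    rw [Finset.sum_comm, Finset.sum_mul]
    refine Finset.sum_congr rfl fun i _ => ?_
    rw [Finset.sum_ite_eq' Finset.univ (Function.update z a i), if_pos (Finset.mem_univ _)]
    rfl
  rw [hL]
  have hj : ∀ (x : B → Bool) (i : Bool), ∑ j, P.mat i j * rawState a B U x j i =
      ∑ z : Bits n, P.mat i (z a) *
        (agrees B x z * (amp U z * conj (amp U (Function.update z a i)))) := by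
    intro x i
    simp only [rawState_apply haB, Finset.mul_sum, mul_ite, mul_zero]
    rw [Finset.sum_comm]
    refine Finset.sum_congr rfl fun z _ => ?_
    rw [Finset.sum_ite_eq Finset.univ (z a), if_pos (Finset.mem_univ _)]
  simp only [hj, Finset.mul_sum]
  rw [Finset.sum_comm]
  conv_rhs => rw [Finset.sum_comm]
  refine Finset.sum_congr rfl fun i _ => ?_
  rw [Finset.sum_comm]
  refine Finset.sum_congr rfl fun z _ => ?_
  rw [← sum_mul_agrees B (fun x => (bitChar r x : ℂ)) z, Finset.mul_sum, Finset.mul_sum,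
    Finset.sum_mul]
  exact Finset.sum_congr rfl fun x _ => by ring

/-- The average purity is controlled by the squared expectations of the operators
`P_A ⊗ Z(r)_B` with `P ≠ I`. -/
theorem avgPurity_le {n : ℕ} {a : Fin n} {B : Finset (Fin n)} (haB : a ∉ B) {U : Op n}
    (hU : Uᴴ * U = 1) :
    avgPurity a B U ≤ 1 / 2 + 1 / 2 * Real.sqrt
      (∑ t ∈ ({Pauli.X, Pauli.Y, Pauli.Z} : Finset Pauli) ×ˢ (Finset.univ : Finset (B → Bool)),
        expect U (pauliString (killerLabel a B t.1 t.2)) ^ 2) := by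
  have h1 : ∑ t ∈ ({Pauli.X, Pauli.Y, Pauli.Z} : Finset Pauli) ×ˢ
      (Finset.univ : Finset (B → Bool)), expect U (pauliString (killerLabel a B t.1 t.2)) ^ 2 =
      (Fintype.card (B → Bool) : ℝ) * ∑ x, blochSq a B U x := by
    rw [Finset.sum_product]
    simp only [expect_killerLabel haB, sum_sq_sum_bitChar, blochSq]
    rw [← Finset.mul_sum, Finset.sum_comm]
    simp
  have h2 : ∑ x, Real.sqrt (blochSq a B U x) ≤
      Real.sqrt ((Fintype.card (B → Bool) : ℝ) * ∑ x, blochSq a B U x) := by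
    refine Real.le_sqrt_of_sq_le ?_
    refine (sq_sum_le_card_mul_sum_sq (s := Finset.univ)).trans (le_of_eq ?_)
    simp only [Real.sq_sqrt (blochSq_nonneg a B U _), Finset.card_univ]
  rw [h1]
  calc avgPurity a B U ≤ ∑ x : B → Bool,
        (1 / 2 * outcomeProb B U x + 1 / 2 * Real.sqrt (blochSq a B U x)) :=
        Finset.sum_le_sum fun x _ => avgPurity_term_le haB U x
    _ = 1 / 2 + 1 / 2 * ∑ x, Real.sqrt (blochSq a B U x) := by
        rw [Finset.sum_add_distrib, ← Finset.mul_sum, ← Finset.mul_sum, sum_outcomeProb B hU,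
          mul_one]
    _ ≤ _ := by linarith

theorem avgPurity_nonneg {n : ℕ} {a : Fin n} {B : Finset (Fin n)} (haB : a ∉ B) (U : Op n) :
    0 ≤ avgPurity a B U := by
  refine Finset.sum_nonneg fun x _ => ?_
  rw [avgPurity_term haB]
  have := outcomeProb_nonneg haB U x
  have := blochSq_nonneg a B U x
  positivity

theorem avgPurity_le_one {n : ℕ} {a : Fin n} {B : Finset (Fin n)} (haB : a ∉ B) {U : Op n}
    (hU : Uᴴ * U = 1) : avgPurity a B U ≤ 1 := by
  rw [← sum_outcomeProb B hU]
  refine Finset.sum_le_sum fun x _ => (avgPurity_term_le haB U x).trans ?_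
  have : Real.sqrt (blochSq a B U x) ≤ outcomeProb B U x :=
    Real.sqrt_le_iff.mpr ⟨outcomeProb_nonneg haB U x, blochSq_le haB U x⟩
  linarith

theorem integrable_avgPurity {k n m : ℕ} (e : Fin m → (Fin k ↪ Fin n)) {a : Fin n}
    {B : Finset (Fin n)} (haB : a ∉ B) :
    Integrable (fun V : Fin m → QU k => avgPurity a B (circuit e V)) (haarGates k m) := by
  have : IsProbabilityMeasure (haarGates k m) := by unfold haarGates; infer_instance
  have hq : ∀ x : B → Bool, Continuous fun V : Fin m → QU k => outcomeProb B (circuit e V) x :=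
    fun x => continuous_expect_circuit e (proj B x)
  have hraw : ∀ (x : B → Bool) (i j : Bool),
      Continuous fun V : Fin m → QU k => rawState a B (circuit e V) x i j := fun x i j => by
    have hamp : ∀ y, Continuous fun V : Fin m → QU k => amp (circuit e V) y := fun y =>
      (continuous_circuit e).matrix_elem _ _
    simp only [rawState_apply haB]
    refine continuous_finsetSum _ fun y _ => ?_
    split_ifs
    · exact continuous_const.mul ((hamp _).mul (Complex.continuous_conj.comp (hamp _)))
    · exact continuous_const
  have hb : ∀ x : B → Bool, Continuous fun V : Fin m → QU k => blochSq a B (circuit e V) x :=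
    fun x => continuous_finsetSum _ fun P _ => Continuous.pow (Complex.continuous_re.comp
      (continuous_finsetSum _ fun i _ => continuous_finsetSum _ fun j _ =>
        continuous_const.mul (hraw x j i))) 2
  refine Integrable.of_bound (C := 1) ?_ (Filter.Eventually.of_forall fun V => ?_)
  · refine Measurable.aestronglyMeasurable ?_
    simp only [avgPurity, avgPurity_term haB]
    refine Finset.measurable_fun_sum _ fun x _ => ?_
    have h1 := (hq x).measurable
    have h2 := (hb x).measurable
    exact (h1.mul (h1.inv.pow_const 2)).mul (((h1.pow_const 2).add h2).div_const 2)
  · rw [Real.norm_of_nonneg (avgPurity_nonneg haB _)]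
    exact avgPurity_le_one haB (circuit_conjTranspose_mul_self e V)

theorem integral_avgPurity_le {k n m : ℕ} (e : Fin m → (Fin k ↪ Fin n)) {a : Fin n}
    {B : Finset (Fin n)} (haB : a ∉ B) :
    ∫ V, avgPurity a B (circuit e V) ∂(haarGates k m) ≤
      1 / 2 + 1 / 2 * Real.sqrt (expectedKillers e a B) := by
  have : IsProbabilityMeasure (haarGates k m) := by unfold haarGates; infer_instance
  set T := ({Pauli.X, Pauli.Y, Pauli.Z} : Finset Pauli) ×ˢ (Finset.univ : Finset (B → Bool))
    with hT
  set G : (Fin m → QU k) → ℝ := fun V =>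
    ∑ t ∈ T, expect (circuit e V) (pauliString (killerLabel a B t.1 t.2)) ^ 2 with hG
  have hsq : ∀ p : Fin n → Pauli, Continuous fun V : Fin m → QU k =>
      expect (circuit e V) (pauliString p) ^ 2 := fun p =>
    (continuous_expect_circuit e _).pow 2
  have hGc : Continuous G := continuous_finsetSum _ fun t _ => hsq _
  have hGn : ∀ V, 0 ≤ G V := fun V => Finset.sum_nonneg fun t _ => sq_nonneg _
  have hinth : ∀ {F : (Fin m → QU k) → ℝ}, Continuous F → Integrable F (haarGates k m) :=
    fun hF => by
      unfold haarGates
      exact integrable_of_continuous _ hF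
  have hGint : ∫ V, G V ∂(haarGates k m) = expectedKillers e a B := by
    rw [expectedKillers_eq e haB, hG, integral_finsetSum _ fun t _ => hinth (hsq _)]
    refine Finset.sum_congr rfl fun t _ => ?_
    simp only [pow_two]
    exact (isCliffordInvariant_haarU k).integral_expect_mul_expect e _ _
  have hjensen : ∫ V, Real.sqrt (G V) ∂(haarGates k m) ≤
      Real.sqrt (∫ V, G V ∂(haarGates k m)) :=
    Real.strictConcaveOn_sqrt.concaveOn.le_map_integral Real.continuous_sqrt.continuousOn
      isClosed_Ici (Filter.Eventually.of_forall hGn) (hinth hGc)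
      (hinth (Real.continuous_sqrt.comp hGc))
  rw [hGint] at hjensen
  calc ∫ V, avgPurity a B (circuit e V) ∂(haarGates k m)
      ≤ ∫ V, (1 / 2 + 1 / 2 * Real.sqrt (G V)) ∂(haarGates k m) :=
        integral_mono (integrable_avgPurity e haB)
          (hinth (continuous_const.add (continuous_const.mul (Real.continuous_sqrt.comp hGc))))
          fun V => avgPurity_le haB (circuit_conjTranspose_mul_self e V)
    _ = 1 / 2 + 1 / 2 * ∫ V, Real.sqrt (G V) ∂(haarGates k m) := by
        have h := integral_add (μ := haarGates k m) (f := fun _ => (1 / 2 : ℝ))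
          (g := fun V => 1 / 2 * Real.sqrt (G V)) (integrable_const _)
          (hinth (continuous_const.mul (Real.continuous_sqrt.comp hGc)))
        rw [h, integral_const_mul]
        simp
    _ ≤ _ := by linarith

end MIE

end

theorem theorem1 (n k m : ℕ) (e : Fin m → (Fin k ↪ Fin n)) (a : Fin n) (B C : Finset (Fin n))
    (haB : a ∉ B) (haC : a ∉ C) (hBC : Disjoint B C) (hABC : insert a (B ∪ C) = Finset.univ) :
    Integrable (fun V : Fin m → MIE.QU k => MIE.avgPurity a B (MIE.circuit e V))
        (MIE.haarGates k m) ∧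
      (∫ V, MIE.avgPurity a B (MIE.circuit e V) ∂(MIE.haarGates k m)) ≤
        1 / 2 + 1 / 2 * Real.sqrt (3 * MIE.expectedKillers e a B) ∧
      MIE.expectedKillers e a B / 3 ≤ MIE.chi e a B ∧
      (∫ V, MIE.avgPurity a B (MIE.circuit e V) ∂(MIE.haarGates k m)) ≤
        1 / 2 + 3 / 2 * Real.sqrt (MIE.chi e a B) := by
  have hE : 0 ≤ MIE.expectedKillers e a B := by
    unfold MIE.expectedKillers
    positivity
  have hpur := MIE.integral_avgPurity_le e haB
  have hchi : MIE.expectedKillers e a B / 3 ≤ MIE.chi e a B := by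
    have h1 := MIE.expectedKillers_le e haB
    have h2 := MIE.sum_pairMoment_le_chi e haB
    linarith
  have h3 : Real.sqrt (MIE.expectedKillers e a B) ≤
      Real.sqrt (3 * MIE.expectedKillers e a B) := Real.sqrt_le_sqrt (by linarith)
  have h9 : Real.sqrt (3 * MIE.expectedKillers e a B) ≤ 3 * Real.sqrt (MIE.chi e a B) := by
    have : (3 : ℝ) * Real.sqrt (MIE.chi e a B) = Real.sqrt (3 ^ 2 * MIE.chi e a B) := by
      rw [Real.sqrt_mul (by norm_num), Real.sqrt_sq (by norm_num)]
    rw [this]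
    exact Real.sqrt_le_sqrt (by linarith)
  exact ⟨MIE.integrable_avgPurity e haB, by linarith, hchi, by linarith⟩
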